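/- Let $1<p<\infty$, $p'=\frac{p}{p-1}$, and use the convention $0\cdot\infty=0$. For $1\le r<\infty$ let $\mathscr V_r$ be the set of weights $v\in L^r_{\rm loc}(0,\infty)$, $v\ge 0$, $\|v\|_{L^1(0,\infty)}\ne 0$. For a weight $u$ with values in $[0,\infty]$ let $L^r_u$ be the set of measurable functions $h:(0,\infty)\to\mathbb R$ with $\|h\|_{r,u}:=\|uh\|_{L^r(0,\infty)}<\infty$. Let $v_0,v_1\in\mathscr V_p$ with $\frac1{v_1}\in L^{p'}_{\rm loc}(0,\infty)$, and assume that for some $c\in(0,\infty)$ $$\|v_1^{-1}\|_{L^{p'}(0,c)}\|v_0\|_{L^p(0,c)}=\|v_1^{-1}\|_{L^{p'}(c,\infty)}\|v_0\|_{L^p(c,\infty)}=\infty .$$ For $t>0$ let $0<a(t)<t<b(t)<\infty$ be the (unique) numbers with $$\int_{a(t)}^t v_1^{-p'}=\int_t^{b(t)}v_1^{-p'},\qquad \Bigl(\int_{a(t)}^{b(t)}v_1^{-p'}\Bigr)^{1/p'}\Bigl(\int_{a(t)}^{b(t)}v_0^{p}\Bigr)^{1/p}=1,$$ let $V_1(t)=\int_{a(t)}^{b(t)}v_1^{-p'}$,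 and let $a^{-1}$ be the inverse of the strictly increasing function $a$ (with $a^{-1}(t)=\infty$ if $t\ge\sup a$). Put $$\mathbb G(g)=\biggl(\int_0^\infty v_1^{-p'}(t)\biggl|\int_t^{a^{-1}(t)}\frac{g(x)}{V_1(x)}\Bigl(\int_{a(x)}^t v_1^{-p'}\Bigr)dx\biggr|^{p'}dt\biggr)^{1/p'},$$ $$\mathcal G(g)=\biggl(\int_0^\infty v_1^{-p'}(t)V_1^{p'}(t)\biggl|\int_t^{a^{-1}(t)}\frac{g(x)}{V_1(x)}\,dx\biggr|^{p'}dt\biggr)^{1/p'}.$$ Let $\mathscr W=\mathscr W_{p',1/v_1}$ be the space of all $g\in L^1_{\rm loc}(0,\infty)$ with $\|g\|_{\mathscr W}:=\mathbb G(g)+\mathcal G(g)<\infty$ (and with $g\in L^1(t,\infty)$ for those $t$, if any, with $a^{-1}(t)=\infty$). Let $\mathfrak D_{\mathscr W}$ be the set of measurable $f:(0,\infty)\to\mathbb R$ with $\int_0^\infty|fg|<\infty$ for all $g\in\mathscr W$, and for $f\in\mathfrak D_{\mathscr W}$ let $$J_{\mathscr W}(f)=\sup_{0\ne g\in\mathscr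 W}\frac{\bigl|\int_0^\infty fg\bigr|}{\|g\|_{\mathscr W}}\in[0,\infty].$$ Then there is a constant $C>0$ depending only on $p$ such that: (i) $L^{p'}_{1/v_0}\subset\mathscr W$, and $\|g\|_{\mathscr W}\le C\,\|g\|_{p',1/v_0}$ for every $g\in L^{p'}_{1/v_0}$; (ii) every $f\in\mathfrak D_{\mathscr W}$ lies in $L^p_{v_0}$ and satisfies $\|f\|_{p,v_0}\le C\,J_{\mathscr W}(f)$. -/

import Mathlib

open MeasureTheory Set
open scoped ENNReal

noncomputable section

namespace WeightedSobolev

/-- The norm `‖h‖_{L^r(s)} = (∫_s h^r)^{1/r}` of a `[0,∞]`-valued function. -/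
def lrNorm (r : ℝ) (s : Set ℝ) (h : ℝ → ℝ≥0∞) : ℝ≥0∞ :=
  (∫⁻ x in s, h x ^ r) ^ (1 / r)

/-- `h ∈ L^r_loc(0,∞)` (a size condition; measurability is required separately). -/
def LocLr (r : ℝ) (h : ℝ → ℝ≥0∞) : Prop :=
  ∀ α β : ℝ, 0 < α → α < β → ∫⁻ x in Icc α β, h x ^ r < ∞

/-- The weight `v`, as a `[0,∞]`-valued function. -/
def wt (v : ℝ → ℝ) : ℝ → ℝ≥0∞ := fun x => ENNReal.ofReal (v x)

/-- The reciprocal weight `1/v`, equal to `∞` where `v = 0`. -/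
def wtInv (v : ℝ → ℝ) : ℝ → ℝ≥0∞ := fun x => (ENNReal.ofReal (v x))⁻¹

/-- The class `𝒱_r(0,∞)` of weights. -/
structure IsWeight (r : ℝ) (v : ℝ → ℝ) : Prop where
  aemeasurable : AEMeasurable v (volume.restrict (Ioi 0))
  nonneg : ∀ᵐ x ∂(volume.restrict (Ioi (0 : ℝ))), 0 ≤ v x
  locLr : LocLr r (wt v)
  ne_zero : ∫⁻ x in Ioi (0 : ℝ), wt v x ≠ 0

/-- There is `c ∈ (0,∞)` with
`‖1/v₁‖_{L^{p'}(0,c)} ‖v₀‖_{L^p(0,c)} = ‖1/v₁‖_{L^{p'}(c,∞)} ‖v₀‖_{L^p(c,∞)} = ∞`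
(with `0 · ∞ = 0`). -/
def DivergenceCondition (p : ℝ) (v₀ v₁ : ℝ → ℝ) : Prop :=
  ∃ c : ℝ, 0 < c ∧
    lrNorm p.conjExponent (Ioo 0 c) (wtInv v₁) * lrNorm p (Ioo 0 c) (wt v₀) = ∞ ∧
    lrNorm p.conjExponent (Ioi c) (wtInv v₁) * lrNorm p (Ioi c) (wt v₀) = ∞

/-- The integral `∫_α^β v₁^{-p'}`. -/
def massInv (p : ℝ) (v₁ : ℝ → ℝ) (α β : ℝ) : ℝ≥0∞ :=
  ∫⁻ x in Ioo α β, wtInv v₁ x ^ p.conjExponent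

/-- The conditions that determine `(a(t), b(t))`: `0 < a(t) < t < b(t) < ∞`, the equilibrium condition
`∫_{a(t)}^t v₁^{-p'} = ∫_t^{b(t)} v₁^{-p'}`, and
`(∫_{a(t)}^{b(t)} v₁^{-p'})^{1/p'} (∫_{a(t)}^{b(t)} v₀^p)^{1/p} = 1`. -/
def IsBalancedPair (p : ℝ) (v₀ v₁ : ℝ → ℝ) (t : ℝ) (q : ℝ × ℝ) : Prop :=
  0 < q.1 ∧ q.1 < t ∧ t < q.2 ∧
    massInv p v₁ q.1 t = massInv p v₁ t q.2 ∧
    massInv p v₁ q.1 q.2 ^ (1 / p.conjExponent) * lrNorm p (Ioo q.1 q.2) (wt v₀) = 1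

/-- The pair `(a(t), b(t))`. -/
def balancedPair (p : ℝ) (v₀ v₁ : ℝ → ℝ) (t : ℝ) : ℝ × ℝ :=
  Classical.epsilon (IsBalancedPair p v₀ v₁ t)

/-- The function `a`. -/
def aFun (p : ℝ) (v₀ v₁ : ℝ → ℝ) (t : ℝ) : ℝ := (balancedPair p v₀ v₁ t).1

/-- The function `b`. -/
def bFun (p : ℝ) (v₀ v₁ : ℝ → ℝ) (t : ℝ) : ℝ := (balancedPair p v₀ v₁ t).2

/-- `V₁(t) = ∫_{a(t)}^{b(t)} v₁^{-p'}`. -/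
def V1 (p : ℝ) (v₀ v₁ : ℝ → ℝ) (t : ℝ) : ℝ≥0∞ :=
  massInv p v₁ (aFun p v₀ v₁ t) (bFun p v₀ v₁ t)

/-- The interval `(t, a⁻¹(t))`, for an increasing function `a` with `a(x) < x`. If `a` stays below `t`
this is `(t, ∞)`, that is, `a⁻¹(t) = ∞`. -/
def window (a : ℝ → ℝ) (t : ℝ) : Set ℝ := {x | t < x ∧ a x < t}

theorem window_eq_Ioo {a : ℝ → ℝ} (ha : StrictMonoOn a (Ioi 0)) {s t : ℝ} (ht : 0 < t)
    (hs : 0 < s) (hst : a s = t) : window a t = Ioo t s := by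
  ext x
  simp only [window, mem_ofPred_eq, mem_Ioo, and_congr_right_iff]
  intro hx
  rw [← hst]
  exact ha.lt_iff_lt (show x ∈ Ioi (0 : ℝ) from ht.trans hx) hs

/-- `𝔾(g) = (∫_0^∞ v₁^{-p'}(t) |∫_t^{a⁻¹(t)} (g(x)/V₁(x)) (∫_{a(x)}^t v₁^{-p'}) dx|^{p'} dt)^{1/p'}`. -/
def bbG (p : ℝ) (v₀ v₁ g : ℝ → ℝ) : ℝ≥0∞ :=
  (∫⁻ t in Ioi (0 : ℝ), wtInv v₁ t ^ p.conjExponent *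
    ‖∫ x in window (aFun p v₀ v₁) t,
        g x / (V1 p v₀ v₁ x).toReal * (massInv p v₁ (aFun p v₀ v₁ x) t).toReal‖ₑ
      ^ p.conjExponent) ^ (1 / p.conjExponent)

/-- `𝒢(g) = (∫_0^∞ v₁^{-p'}(t) V₁^{p'}(t) |∫_t^{a⁻¹(t)} g(x)/V₁(x) dx|^{p'} dt)^{1/p'}`. -/
def calG (p : ℝ) (v₀ v₁ g : ℝ → ℝ) : ℝ≥0∞ :=
  (∫⁻ t in Ioi (0 : ℝ), wtInv v₁ t ^ p.conjExponent * V1 p v₀ v₁ t ^ p.conjExponent *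
    ‖∫ x in window (aFun p v₀ v₁) t, g x / (V1 p v₀ v₁ x).toReal‖ₑ
      ^ p.conjExponent) ^ (1 / p.conjExponent)

/-- The norm of the space `𝒲_{p',1/v₁}`. -/
def normW (p : ℝ) (v₀ v₁ g : ℝ → ℝ) : ℝ≥0∞ := bbG p v₀ v₁ g + calG p v₀ v₁ g

/-- `g ∈ 𝒲_{p',1/v₁}`: `g ∈ L¹_loc(0,∞)` and `𝔾(g) + 𝒢(g) < ∞`. The second field follows from the
first one whenever `a⁻¹(t) < ∞`; where `a⁻¹(t) = ∞` it says that the integrals over `(t, a⁻¹(t))`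
converge. -/
structure MemW (p : ℝ) (v₀ v₁ g : ℝ → ℝ) : Prop where
  locallyIntegrableOn : LocallyIntegrableOn g (Ioi 0)
  integrableOn_window : ∀ t : ℝ, 0 < t → IntegrableOn g (window (aFun p v₀ v₁) t)
  norm_lt_top : normW p v₀ v₁ g < ∞

/-- `‖h‖_{r,u} = ‖u h‖_{L^r(0,∞)}`, for a weight `u` with values in `[0,∞]` (with `0 · ∞ = 0`). -/
def wNorm (r : ℝ) (u : ℝ → ℝ≥0∞) (h : ℝ → ℝ) : ℝ≥0∞ :=
  lrNorm r (Ioi 0) fun x => u x * ‖h x‖ₑ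

/-- `h ∈ L^r_u(0,∞)`. -/
structure MemLw (r : ℝ) (u : ℝ → ℝ≥0∞) (h : ℝ → ℝ) : Prop where
  aemeasurable : AEMeasurable h (volume.restrict (Ioi 0))
  norm_lt_top : wNorm r u h < ∞

/-- `f ∈ 𝔇_X`, where `X` is a class of functions on `(0,∞)`: `f` is measurable and
`∫_0^∞ |f g| < ∞` for all `g ∈ X`. -/
structure MemD (X : (ℝ → ℝ) → Prop) (f : ℝ → ℝ) : Prop where
  aemeasurable : AEMeasurable f (volume.restrict (Ioi 0))
  lintegral_lt_top : ∀ g, X g → ∫⁻ x in Ioi (0 : ℝ), ‖f x * g x‖ₑ < ∞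

/-- `J_X(f) = sup_{0 ≠ g ∈ X} |∫_0^∞ f g| / ‖g‖_X ∈ [0,∞]`. -/
def weakJ (X : (ℝ → ℝ) → Prop) (N : (ℝ → ℝ) → ℝ≥0∞) (f : ℝ → ℝ) : ℝ≥0∞ :=
  ⨆ (g : ℝ → ℝ) (_ : X g) (_ : ¬ g =ᵐ[volume.restrict (Ioi 0)] 0),
    ‖∫ x in Ioi (0 : ℝ), f x * g x‖ₑ / N g

end WeightedSobolev

end

open Filter Topology

/-! Write q = p'. Both integrands are controlled by the Hardy–Steklov operator g ↦ ∫_{W(t)} |g|,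
where W(t) = (t, a⁻¹(t)): the kernel in 𝔾 is at most 1, and in 𝒢 one has V₁(t) ≤ 2 V₁(x) for x ∈
W(t). So (i) reduces to the boundedness of this operator from L^q_{1/v₀} to L^q with weight v₁^{-q}.

Raised to the power p, the balance condition reads V₁(t)^{p-1} ∫_{a(t)}^{b(t)} v₀^p = 1. Since V₁ is
almost increasing on a window and (t, y) ⊂ (a(y), b(y)) for y ∈ W(t), it follows that ∫_{W(t)} v₀^p
V₁^{p-1} ≤ 2^{p-1} (`setLIntegral_window_le`). Hölder then gives (∫_{W(t)} |g|)^q ≤ 2 ∫_{W(t)}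
(|g|/v₀)^q / V₁ (`setLIntegral_window_rpow_le`). Integrating against v₁^{-q}(t) and exchanging the
integrals, each x meets only t ∈ (a(x), x), whose mass is at most V₁(x) and absorbs the factor
1/V₁(x) (`hardySteklov_le`).

Part (ii) is dual: by (i), f may be tested against every g ∈ L^q_{1/v₀}. Landau's theorem gives f ∈
L^p_{v₀}, and nearly extremal g give the bound (`memLw_and_wNorm_le_weakJ`).

Since a and b are chosen values, existence of balanced pairs is proved as well, by the intermediate
value theorem (`exists_balanced`). -/

namespace WeightedSobolev

/-! ### Exhaustions, primitives and continuous inverses -/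

/-- Monotone exhaustion of a set `S` lying to the right of `t` and closed towards `t`. -/
theorem setLIntegral_le_of_forall_Ioo_left {S : Set ℝ} {t : ℝ} (hS : ∀ y ∈ S, t < y)
    (hS' : ∀ y ∈ S, Ioo t y ⊆ S) {φ : ℝ → ℝ≥0∞} {C : ℝ≥0∞}
    (h : ∀ y ∈ S, ∫⁻ x in Ioo t y, φ x ≤ C) : ∫⁻ x in S, φ x ≤ C := by
  set U : Set ℝ := ⋃ r : {r : ℚ // (r : ℝ) ∈ S}, Ioo t (r : ℝ) with hU
  -- Rational right endpoints make the union countable; it misses at most the greatest element of S,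
  -- a null set.
  have hsub : S ⊆ U ∪ {m | m ∈ S ∧ ∀ y ∈ S, y ≤ m} := by
    intro x hx
    by_cases hm : ∀ y ∈ S, y ≤ x
    · exact Or.inr ⟨hx, hm⟩
    · push Not at hm
      obtain ⟨y, hy, hxy⟩ := hm
      obtain ⟨r, hr1, hr2⟩ := exists_rat_btwn hxy
      refine Or.inl (mem_iUnion.2 ⟨⟨r, hS' y hy ⟨(hS x hx).trans hr1, hr2⟩⟩, hS x hx, hr1⟩)
  have hnull : volume {m | m ∈ S ∧ ∀ y ∈ S, y ≤ m} = 0 := by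
    refine Set.Subsingleton.measure_zero ?_ _
    rintro x ⟨hx, hx'⟩ y ⟨hy, hy'⟩
    exact le_antisymm (hy' x hx) (hx' y hy)
  have hd : Directed (· ⊆ ·) fun r : {r : ℚ // (r : ℝ) ∈ S} => Ioo t (r : ℝ) := by
    refine Monotone.directed_le fun r s hrs => Ioo_subset_Ioo_right ?_
    exact_mod_cast hrs
  calc ∫⁻ x in S, φ x ≤ ∫⁻ x in U ∪ {m | m ∈ S ∧ ∀ y ∈ S, y ≤ m}, φ x :=
        lintegral_mono_set hsub
    _ ≤ (∫⁻ x in U, φ x) + ∫⁻ x in {m | m ∈ S ∧ ∀ y ∈ S, y ≤ m}, φ x := lintegral_union_le _ _ _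
    _ = ∫⁻ x in U, φ x := by rw [setLIntegral_measure_zero _ _ hnull, add_zero]
    _ ≤ C := by
        rw [hU, setLIntegral_iUnion_of_directed _ hd]
        exact iSup_le fun r => h r r.2

theorem setLIntegral_Ioo_zero_le {c : ℝ} (hc : 0 < c) {φ : ℝ → ℝ≥0∞} {C : ℝ≥0∞}
    (h : ∀ α, 0 < α → α < c → ∫⁻ x in Ioo α c, φ x ≤ C) : ∫⁻ x in Ioo 0 c, φ x ≤ C := by
  have hsub : Ioo 0 c ⊆ ⋃ n : ℕ, Ioo (c / (n + 2)) c := by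
    rintro x ⟨hx0, hxc⟩
    obtain ⟨n, hn⟩ := exists_nat_gt (c / x)
    refine mem_iUnion.2 ⟨n, ?_, hxc⟩
    rw [div_lt_iff₀ hx0] at hn
    rw [div_lt_iff₀ (by positivity)]
    nlinarith
  have hd : Directed (· ⊆ ·) fun n : ℕ => Ioo (c / ((n : ℝ) + 2)) c := by
    refine Monotone.directed_le fun n m hnm => Ioo_subset_Ioo_left ?_
    have : (n : ℝ) ≤ m := by exact_mod_cast hnm
    gcongr
  refine (lintegral_mono_set hsub).trans ?_
  rw [setLIntegral_iUnion_of_directed _ hd]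
  refine iSup_le fun n => h _ (by positivity) ?_
  rw [div_lt_iff₀ (by positivity)]
  nlinarith [n.cast_nonneg (α := ℝ)]

/-- A locally integrable density on `(0,∞)` has a continuous primitive. -/
theorem exists_primitive {φ : ℝ → ℝ≥0∞} (hφ : AEMeasurable φ (volume.restrict (Ioi 0)))
    (hfin : ∀ α β : ℝ, 0 < α → α < β → ∫⁻ x in Icc α β, φ x < ∞) :
    ∃ m : ℝ → ℝ, ContinuousOn m (Ioi 0) ∧ MonotoneOn m (Ioi 0) ∧
      ∀ α β, 0 < α → α ≤ β → ∫⁻ x in Ioo α β, φ x = ENNReal.ofReal (m β - m α) := by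
  have hint : ∀ α β : ℝ, 0 < α → α < β → IntegrableOn (fun x => (φ x).toReal) (Icc α β) :=
    fun α β hα hαβ => integrable_toReal_of_lintegral_ne_top
      (hφ.mono_measure (Measure.restrict_mono (fun x hx => hα.trans_le hx.1) le_rfl))
      (hfin α β hα hαβ).ne
  have hii : ∀ α β : ℝ, 0 < α → α ≤ β →
      IntervalIntegrable (fun x => (φ x).toReal) volume α β := by
    intro α β hα hαβ
    rw [intervalIntegrable_iff_integrableOn_Icc_of_le hαβ]
    exact (hint α (β + 1) hα (by linarith)).mono_set (Icc_subset_Icc_right (by linarith))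
  have hii' : ∀ α β : ℝ, 0 < α → 0 < β →
      IntervalIntegrable (fun x => (φ x).toReal) volume α β := by
    intro α β hα hβ
    rcases le_total α β with h | h
    · exact hii α β hα h
    · exact (hii β α hβ h).symm
  have hdiff : ∀ α β : ℝ, 0 < α → α ≤ β →
      (∫ x in (1 : ℝ)..β, (φ x).toReal) - ∫ x in (1 : ℝ)..α, (φ x).toReal
        = ∫ x in Ioo α β, (φ x).toReal := by
    intro α β hα hαβ
    rw [intervalIntegral.integral_interval_sub_left
      (hii' 1 β one_pos (hα.trans_le hαβ)) (hii' 1 α one_pos hα),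
      intervalIntegral.integral_of_le hαβ, integral_Ioc_eq_integral_Ioo]
  -- The base point is 1, not 0, because φ need not be integrable near 0.
  refine ⟨fun x => ∫ y in (1 : ℝ)..x, (φ y).toReal, ?_, ?_, ?_⟩
  · intro x hx
    have hx : 0 < x := hx
    have h1 : 0 < min 1 (x / 2) := by positivity
    have h2 : min 1 (x / 2) ≤ max 1 (x + 1) := (min_le_left _ _).trans (le_max_left _ _)
    have := intervalIntegral.continuousOn_primitive_interval' (a := 1)
      (hii (min 1 (x / 2)) (max 1 (x + 1)) h1 h2)
      (by rw [uIcc_of_le h2]; exact ⟨min_le_left _ _, le_max_left _ _⟩)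
    refine (this.continuousAt ?_).continuousWithinAt
    rw [uIcc_of_le h2]
    refine Icc_mem_nhds ?_ ?_
    · exact (min_le_right _ _).trans_lt (by linarith)
    · exact (lt_add_one x).trans_le (le_max_right _ _)
  · intro α hα β hβ hαβ
    have := hdiff α β hα hαβ
    have h0 : 0 ≤ ∫ x in Ioo α β, (φ x).toReal :=
      integral_nonneg fun x => ENNReal.toReal_nonneg
    change (∫ x in (1 : ℝ)..α, (φ x).toReal) ≤ ∫ x in (1 : ℝ)..β, (φ x).toReal
    linarith
  · intro α β hα hαβ
    simp only []
    rw [hdiff α β hα hαβ]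
    have hle : Ioo α β ⊆ Icc α (β + 1) := fun x hx => ⟨hx.1.le, by linarith [hx.2]⟩
    have hne : ∫⁻ x in Ioo α β, φ x ≠ ∞ :=
      ((lintegral_mono_set hle).trans_lt (hfin α (β + 1) hα (by linarith))).ne
    have hm : AEMeasurable φ (volume.restrict (Ioo α β)) :=
      hφ.mono_measure (Measure.restrict_mono (fun x hx => hα.trans hx.1) le_rfl)
    rw [integral_toReal hm (ae_lt_top' hm hne), ENNReal.ofReal_toReal hne]

/-- A continuous inverse of a continuous strictly increasing function on a compact interval. -/
theorem exists_continuous_inverse {m : ℝ → ℝ} {α β : ℝ} (hαβ : α ≤ β)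
    (hc : ContinuousOn m (Icc α β)) (hm : StrictMonoOn m (Icc α β)) :
    ∃ j : ℝ → ℝ, Continuous j ∧ (∀ y, j y ∈ Icc α β) ∧ ∀ y ∈ Icc (m α) (m β), m (j y) = y := by
  have hle : m α ≤ m β := hm.monotoneOn ⟨le_rfl, hαβ⟩ ⟨hαβ, le_rfl⟩ hαβ
  let e : Icc α β → Icc (m α) (m β) := fun x =>
    ⟨m x, hm.monotoneOn ⟨le_rfl, hαβ⟩ x.2 x.2.1, hm.monotoneOn x.2 ⟨hαβ, le_rfl⟩ x.2.2⟩
  have he : StrictMono e := fun x y hxy => hm x.2 y.2 hxy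
  have hs : Function.Surjective e := by
    rintro ⟨y, hy⟩
    obtain ⟨x, hx, hxy⟩ := intermediate_value_Icc hαβ hc hy
    exact ⟨⟨x, hx⟩, Subtype.ext hxy⟩
  let i := StrictMono.orderIsoOfSurjective e he hs
  refine ⟨fun y => (i.symm (projIcc _ _ hle y) : ℝ), ?_, fun y => (i.symm _).2, ?_⟩
  · exact continuous_subtype_val.comp (i.symm.continuous.comp continuous_projIcc)
  · intro y hy
    have : e (i.symm (projIcc _ _ hle y)) = projIcc _ _ hle y := i.apply_symm_apply _
    have h2 : m (i.symm (projIcc _ _ hle y)) = (projIcc _ _ hle y : ℝ) := congrArg Subtype.val this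
    exact h2.trans (by rw [projIcc_of_mem hle hy])

/-! ### Existence of balanced neighbourhoods, in terms of primitives -/

/-- If a symmetric `m`-neighbourhood of `t` is large enough, a smaller one is exactly balanced. -/
theorem exists_balanced_of_le {m n : ℝ → ℝ} (hm : StrictMonoOn m (Ioi 0))
    (hmc : ContinuousOn m (Ioi 0)) (hnc : ContinuousOn n (Ioi 0)) {r : ℝ} (hr : 0 < r)
    {α t β : ℝ} (hα : 0 < α) (hαt : α < t) (htβ : t < β) (heq : m t - m α = m β - m t)
    (hle : 1 ≤ (m β - m α) ^ r * (n β - n α)) :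
    ∃ a b, 0 < a ∧ a < t ∧ t < b ∧ m t - m a = m b - m t ∧
      (m b - m a) ^ r * (n b - n a) = 1 := by
  have hsub : Icc α β ⊆ Ioi 0 := fun x hx => hα.trans_le hx.1
  have hαβ : α ≤ β := (hαt.trans htβ).le
  obtain ⟨j, hj, hjm, hjr⟩ := exists_continuous_inverse hαβ (hmc.mono hsub) (hm.mono hsub)
  set δ := m t - m α with hδ
  have hinj := (hm.mono hsub).injOn
  have hδ0 : 0 < δ := sub_pos.2 (hm hα (hα.trans hαt) hαt)
  have hj1 : ∀ s ∈ Icc 0 δ, m (j (m t - s)) = m t - s := fun s hs =>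
    hjr _ ⟨by linarith [hs.1, hs.2], by linarith [hs.1, hs.2]⟩
  have hj2 : ∀ s ∈ Icc 0 δ, m (j (m t + s)) = m t + s := fun s hs =>
    hjr _ ⟨by linarith [hs.1, hs.2], by linarith [hs.1, hs.2]⟩
  -- Φ(s) is the balance product of the interval of m-radius s about t. It is continuous with Φ(0) =
  -- 0 and Φ(δ) ≥ 1, so it takes the value 1.
  let Φ : ℝ → ℝ := fun s => (2 * s) ^ r * (n (j (m t + s)) - n (j (m t - s)))
  have hΦ : ContinuousOn Φ (Icc 0 δ) := by
    refine ContinuousOn.mul ?_ (ContinuousOn.sub ?_ ?_)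
    · exact (Continuous.rpow_const (by fun_prop) fun _ => Or.inr hr.le).continuousOn
    · exact hnc.comp (by fun_prop) fun s _ => hsub (hjm _)
    · exact hnc.comp (by fun_prop) fun s _ => hsub (hjm _)
  have hδm : δ ∈ Icc 0 δ := ⟨hδ0.le, le_rfl⟩
  have hjα : j (m t - δ) = α := hinj (hjm _) ⟨le_rfl, hαβ⟩ (by rw [hj1 δ hδm]; linarith)
  have hjβ : j (m t + δ) = β := hinj (hjm _) ⟨hαβ, le_rfl⟩ (by rw [hj2 δ hδm]; linarith)
  have h1 : (1 : ℝ) ∈ Icc (Φ 0) (Φ δ) := by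
    constructor
    · simp [Φ, Real.zero_rpow hr.ne']
    · simp only [Φ, hjα, hjβ]
      rwa [show 2 * δ = m β - m α by linarith]
  obtain ⟨s, hs, hs1⟩ := intermediate_value_Icc hδ0.le hΦ h1
  have hs0 : 0 < s := by
    rcases hs.1.eq_or_lt with h | h
    · rw [← h] at hs1; simp [Φ, Real.zero_rpow hr.ne'] at hs1
    · exact h
  have ht0 : 0 < t := hα.trans hαt
  refine ⟨j (m t - s), j (m t + s), hsub (hjm _), ?_, ?_, ?_, ?_⟩
  · rw [← hm.lt_iff_lt (hsub (hjm _)) ht0, hj1 s hs]; linarith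
  · rw [← hm.lt_iff_lt ht0 (hsub (hjm _)), hj2 s hs]; linarith
  · rw [hj1 s hs, hj2 s hs]; ring
  · rw [hj1 s hs, hj2 s hs, ← hs1]
    simp only [Φ]
    congr 2; ring

theorem exists_preimage {m : ℝ → ℝ} (hmc : ContinuousOn m (Ioi 0)) {α β y : ℝ} (hα : 0 < α)
    (hαβ : α ≤ β) (h1 : m α ≤ y) (h2 : y ≤ m β) : ∃ x ∈ Icc α β, m x = y :=
  intermediate_value_Icc hαβ (hmc.mono fun _ hx => hα.trans_le hx.1) ⟨h1, h2⟩

/-- Balanced neighbourhoods exist at every point. -/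
theorem exists_balanced {m n : ℝ → ℝ} (hm : StrictMonoOn m (Ioi 0)) (hn : MonotoneOn n (Ioi 0))
    (hmc : ContinuousOn m (Ioi 0)) (hnc : ContinuousOn n (Ioi 0)) {r : ℝ} (hr : 0 < r)
    (hne : ∃ α β, 0 < α ∧ α < β ∧ n α < n β)
    (h0 : (∀ L, ∃ x, 0 < x ∧ m x < L) ∨ ∀ L, ∃ x, 0 < x ∧ n x < L)
    (h1 : (∀ L, ∃ x, 0 < x ∧ L < m x) ∨ ∀ L, ∃ x, 0 < x ∧ L < n x) {t : ℝ} (ht : 0 < t) :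
    ∃ a b, 0 < a ∧ a < t ∧ t < b ∧ m t - m a = m b - m t ∧
      (m b - m a) ^ r * (n b - n a) = 1 := by
  suffices ∃ α β, 0 < α ∧ α < t ∧ t < β ∧ m t - m α = m β - m t ∧
      1 ≤ (m β - m α) ^ r * (n β - n α) by
    obtain ⟨α, β, hα, hαt, htβ, heq, hle⟩ := this
    exact exists_balanced_of_le hm hmc hnc hr hα hαt htβ heq hle
  have large : ∀ c : ℝ, 0 < c → ∃ K, 0 < K ∧ 1 ≤ c * K := fun c hc =>
    ⟨c⁻¹, inv_pos.2 hc, (mul_inv_cancel₀ hc.ne').ge⟩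
  -- The question is whether every point left of t has an m-reflection on the right. If so,
  -- divergence at 0 is used; if not, m is bounded above, and n must diverge at ∞.
  by_cases hA : ∀ α, 0 < α → α < t → ∃ β, t < β ∧ 2 * m t - m α ≤ m β
  · rcases h0 with h0 | h0
    · obtain ⟨α₀, β₀, hα₀, hαβ₀, hnn⟩ := hne
      set α₁ := min α₀ (t / 2)
      set β₁ := max β₀ (t + 1)
      have hα₁ : 0 < α₁ := by positivity
      have hα₁t : α₁ < t := (min_le_right _ _).trans_lt (by linarith)
      have hβ₁t : t < β₁ := (lt_add_one t).trans_le (le_max_right _ _)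
      have hβ₁ : 0 < β₁ := ht.trans hβ₁t
      have hη : 0 < n β₁ - n α₁ := by
        have := hn hα₁ hα₀ (min_le_left _ _)
        have := hn (hα₀.trans hαβ₀) hβ₁ (le_max_left _ _)
        linarith
      obtain ⟨K, hK0, hK⟩ := large _ hη
      -- The m-radius L makes the mass factor at least K and the interval contain [α₁, β₁], on which
      -- n already grows by a positive amount.
      set L := max (K ^ (1 / r)) (max (m β₁ - m t) (m t - m α₁))
      obtain ⟨x, hx, hxL⟩ := h0 (m t - L)
      have hL1 : K ^ (1 / r) ≤ L := le_max_left _ _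
      have hL2 : m β₁ - m t ≤ L := (le_max_left _ _).trans (le_max_right _ _)
      have hL3 : m t - m α₁ ≤ L := (le_max_right _ _).trans (le_max_right _ _)
      have hL0 : 0 < L := (Real.rpow_pos_of_pos hK0 _).trans_le hL1
      have hxt : x < t := by
        rw [← hm.lt_iff_lt hx ht]; linarith
      obtain ⟨y, hy, hyx⟩ := hA x hx hxt
      obtain ⟨α, hα, hαm⟩ := exists_preimage hmc (y := m t - L) hx hxt.le hxL.le (by linarith)
      obtain ⟨β, hβ, hβm⟩ := exists_preimage hmc (y := m t + L) ht hy.le (by linarith)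
        (by linarith)
      have hα0 : 0 < α := hx.trans_le hα.1
      have hβ0 : 0 < β := ht.trans_le hβ.1
      refine ⟨α, β, hα0, ?_, ?_, by linarith, ?_⟩
      · rw [← hm.lt_iff_lt hα0 ht]; linarith
      · rw [← hm.lt_iff_lt ht hβ0]; linarith
      · have e1 : n α ≤ n α₁ := hn hα0 hα₁ (by rw [← hm.le_iff_le hα0 hα₁]; linarith)
        have e2 : n β₁ ≤ n β := hn hβ₁ hβ0 (by rw [← hm.le_iff_le hβ₁ hβ0]; linarith)
        have e3 : K ≤ (m β - m α) ^ r := by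
          calc K = (K ^ (1 / r)) ^ r := by
                rw [← Real.rpow_mul hK0.le, one_div_mul_cancel hr.ne', Real.rpow_one]
            _ ≤ _ := by gcongr; linarith
        have e4 : 0 ≤ n β - n α := by linarith
        calc 1 ≤ (n β₁ - n α₁) * K := hK
          _ ≤ (n β - n α) * (m β - m α) ^ r := by gcongr
          _ = _ := mul_comm _ _
    · have h2 : 0 < t / 2 := by positivity
      have hc : 0 < (m t - m (t / 2)) ^ r :=
        Real.rpow_pos_of_pos (sub_pos.2 (hm h2 ht (by linarith))) _
      obtain ⟨K, hK0, hK⟩ := large _ hc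
      obtain ⟨x, hx, hxL⟩ := h0 (n t - K)
      set α := min x (t / 2)
      have hα : 0 < α := by positivity
      have hαt : α < t := (min_le_right _ _).trans_lt (by linarith)
      have hmα : m α < m t := hm hα ht hαt
      obtain ⟨y, hy, hyx⟩ := hA α hα hαt
      obtain ⟨β, hβ, hβm⟩ := exists_preimage hmc (y := 2 * m t - m α) ht hy.le (by linarith) hyx
      have hβ0 : 0 < β := ht.trans_le hβ.1
      have htβ : t < β := by rw [← hm.lt_iff_lt ht hβ0]; linarith
      refine ⟨α, β, hα, hαt, htβ, by linarith, hK.trans ?_⟩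
      have e1 : n α ≤ n x := hn hα hx (min_le_left _ _)
      have e2 : n t ≤ n β := hn ht hβ0 htβ.le
      have e3 : m α ≤ m (t / 2) := hm.monotoneOn hα h2 (min_le_right _ _)
      have e4 : m (t / 2) < m t := hm h2 ht (by linarith)
      refine mul_le_mul (Real.rpow_le_rpow (by linarith) (by linarith) hr.le) (by linarith) hK0.le
        (Real.rpow_nonneg (by linarith) _)
  · push Not at hA
    obtain ⟨α₀, hα₀, hα₀t, hb⟩ := hA
    have h1 : ∀ L, ∃ x, 0 < x ∧ L < n x := by
      refine h1.resolve_left fun h => ?_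
      obtain ⟨x, hx, hxL⟩ := h (2 * m t - m α₀)
      have := hm hα₀ ht hα₀t
      have hxt : t < x := by rw [← hm.lt_iff_lt ht hx]; linarith
      exact (hb x hxt).not_gt hxL
    have h2 : 0 < t + 1 := by positivity
    have hc : 0 < (m (t + 1) - m t) ^ r :=
      Real.rpow_pos_of_pos (sub_pos.2 (hm ht h2 (by linarith))) _
    obtain ⟨K, hK0, hK⟩ := large _ hc
    obtain ⟨x, hx, hxL⟩ := h1 (n t + K)
    set β := max x (t + 1)
    have htβ : t < β := (lt_add_one t).trans_le (le_max_right _ _)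
    have hβ : 0 < β := ht.trans htβ
    have hmβ : m t < m β := hm ht hβ htβ
    obtain ⟨α, hα', hαm⟩ := exists_preimage hmc (y := 2 * m t - m β) hα₀ hα₀t.le
      (by linarith [hb β htβ]) (by linarith)
    have hα : 0 < α := hα₀.trans_le hα'.1
    have hαt : α < t := by rw [← hm.lt_iff_lt hα ht]; linarith
    refine ⟨α, β, hα, hαt, htβ, by linarith, hK.trans ?_⟩
    have e1 : n x ≤ n β := hn hx hβ (le_max_left _ _)
    have e2 : n α ≤ n t := hn hα ht hαt.le
    have e3 : m (t + 1) ≤ m β := hm.monotoneOn h2 hβ (le_max_right _ _)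
    have e4 : m t < m (t + 1) := hm ht h2 (by linarith)
    refine mul_le_mul (Real.rpow_le_rpow (by linarith) (by linarith) hr.le) (by linarith) hK0.le
      (Real.rpow_nonneg (by linarith) _)

/-! ### Duality of L^p and L^q for functions with values in [0,∞] -/

section Duality

variable {X : Type*} [MeasurableSpace X] {μ : Measure X} {p q : ℝ}

/-- Cutting off both the height and the support along a σ-finite exhaustion makes the integral
finite; monotone convergence recovers the original one. Extremal test functions can then be built
even when the L^p norm of F is infinite. -/
theorem exists_truncation [SigmaFinite μ] {F : X → ℝ≥0∞} (hF : AEMeasurable F μ) (hp : 0 < p)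
    {c : ℝ≥0∞} (hc : c < ∫⁻ x, F x ^ p ∂μ) :
    ∃ h : X → ℝ≥0∞, AEMeasurable h μ ∧ (∀ x, h x ≤ F x) ∧ ∫⁻ x, h x ^ p ∂μ < ∞ ∧
      c < ∫⁻ x, h x ^ p ∂μ := by
  let h : ℕ → X → ℝ≥0∞ := fun n => (spanningSets μ n).indicator fun x => min (F x) n
  have hm : ∀ n, AEMeasurable (h n) μ := fun n =>
    (hF.min aemeasurable_const).indicator (measurableSet_spanningSets μ n)
  have hmono : ∀ x, Monotone fun n => h n x := by
    intro x n k hnk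
    by_cases hx : x ∈ spanningSets μ n
    · have hx' : x ∈ spanningSets μ k := monotone_spanningSets μ hnk hx
      simp only [h, indicator_of_mem hx, indicator_of_mem hx']
      gcongr
    · simp [h, indicator_of_notMem hx]
  have htend : ∀ x, Tendsto (fun n => h n x) atTop (𝓝 (F x)) := by
    intro x
    have hev : ∀ᶠ n : ℕ in atTop, min (F x) (n : ℝ≥0∞) = h n x := by
      obtain ⟨k, hk⟩ := mem_iUnion.1 ((iUnion_spanningSets μ).symm ▸ mem_univ x)
      filter_upwards [eventually_ge_atTop k] with n hn
      simp only [h, indicator_of_mem (monotone_spanningSets μ hn hk)]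
    refine Tendsto.congr' hev ?_
    simpa using tendsto_const_nhds.min ENNReal.tendsto_nat_nhds_top
  have hlim : Tendsto (fun n => ∫⁻ x, h n x ^ p ∂μ) atTop (𝓝 (∫⁻ x, F x ^ p ∂μ)) := by
    refine lintegral_tendsto_of_tendsto_of_monotone (fun n => (hm n).pow_const p) ?_ ?_
    · exact ae_of_all _ fun x n k hnk => ENNReal.rpow_le_rpow (hmono x hnk) hp.le
    · exact ae_of_all _ fun x => ((ENNReal.continuous_rpow_const.tendsto _).comp (htend x))
  obtain ⟨n, hn⟩ := (hlim.eventually_const_lt hc).exists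
  refine ⟨h n, hm n, fun x => ?_, ?_, hn⟩
  · exact indicator_le (fun x _ => min_le_left _ _) x
  · calc ∫⁻ x, h n x ^ p ∂μ ≤ ∫⁻ x, (spanningSets μ n).indicator (fun _ => (n : ℝ≥0∞) ^ p) x ∂μ := by
          refine lintegral_mono fun x => ?_
          by_cases hx : x ∈ spanningSets μ n
          · simp only [h, indicator_of_mem hx]
            gcongr
            exact min_le_right _ _
          · simp [h, indicator_of_notMem hx, ENNReal.zero_rpow_of_pos hp]
      _ = (n : ℝ≥0∞) ^ p * μ (spanningSets μ n) := by
          rw [lintegral_indicator (measurableSet_spanningSets μ n), setLIntegral_const]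
      _ < ∞ := ENNReal.mul_lt_top (ENNReal.rpow_lt_top_of_nonneg hp.le (ENNReal.natCast_ne_top n))
          (measure_spanningSets_lt_top μ n)

/-- The `L^p` norm is almost attained by testing against the unit sphere of `L^q`. -/
theorem exists_dual_test [SigmaFinite μ] (hpq : p.HolderConjugate q) {F : X → ℝ≥0∞}
    (hF : AEMeasurable F μ) {c : ℝ≥0∞} (hc : c < (∫⁻ x, F x ^ p ∂μ) ^ (1 / p)) :
    ∃ u : X → ℝ≥0∞, AEMeasurable u μ ∧ ∫⁻ x, u x ^ q ∂μ = 1 ∧ c ≤ ∫⁻ x, F x * u x ∂μ := by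
  have hp := hpq.pos
  have hq := hpq.symm.pos
  have hcp : c ^ p < ∫⁻ x, F x ^ p ∂μ := by
    have := ENNReal.rpow_lt_rpow hc hp
    rwa [← ENNReal.rpow_mul, one_div_mul_cancel hp.ne', ENNReal.rpow_one] at this
  obtain ⟨h, hm, hle, hfin, hch⟩ := exists_truncation hF hp hcp
  set I := ∫⁻ x, h x ^ p ∂μ
  have hI0 : I ≠ 0 := (bot_le.trans_lt hch).ne'
  have hIq0 : I ^ (1 / q) ≠ 0 := by simp [hI0, hfin.ne]
  have hIq : I ^ (1 / q) ≠ ∞ := by simp [hfin.ne, hI0]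
  -- The case of equality in Hölder's inequality for h: the multiple of h^{p-1} with L^q norm 1.
  refine ⟨fun x => h x ^ (p - 1) * (I ^ (1 / q))⁻¹, (hm.pow_const _).mul_const _, ?_, ?_⟩
  · have : ∀ x, (h x ^ (p - 1) * (I ^ (1 / q))⁻¹) ^ q = h x ^ p * I⁻¹ := by
      intro x
      rw [ENNReal.mul_rpow_of_nonneg _ _ hq.le, ← ENNReal.rpow_mul, hpq.sub_one_mul_conj,
        ENNReal.inv_rpow, ← ENNReal.rpow_mul, one_div_mul_cancel hq.ne', ENNReal.rpow_one]
    simp_rw [this]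
    rw [lintegral_mul_const'' _ (hm.pow_const p)]
    exact ENNReal.mul_inv_cancel hI0 hfin.ne
  · have h1 : c ≤ I ^ (1 / p) := by
      have := ENNReal.rpow_le_rpow hch.le hpq.one_div_nonneg
      rwa [← ENNReal.rpow_mul, mul_one_div_cancel hp.ne', ENNReal.rpow_one] at this
    have h2 : I ^ (1 / p) = I * (I ^ (1 / q))⁻¹ := by
      rw [← ENNReal.rpow_neg]
      nth_rewrite 2 [← ENNReal.rpow_one I]
      rw [← ENNReal.rpow_add _ _ hI0 hfin.ne]
      congr 1
      have := hpq.inv_add_inv_eq_one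
      simp only [one_div]; linarith
    rw [h2] at h1
    refine h1.trans ?_
    rw [← lintegral_mul_const'' _ (hm.pow_const p)]
    refine lintegral_mono fun x => ?_
    rw [← mul_assoc]
    gcongr
    calc h x ^ p = h x ^ (1 + (p - 1)) := by ring_nf
      _ = h x * h x ^ (p - 1) := by
          rw [ENNReal.rpow_add_of_nonneg _ _ zero_le_one hpq.sub_one_pos.le, ENNReal.rpow_one]
      _ ≤ F x * h x ^ (p - 1) := by gcongr; exact hle x

theorem lintegral_rpow_le_of_forall_dual [SigmaFinite μ] (hpq : p.HolderConjugate q)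
    {F : X → ℝ≥0∞} (hF : AEMeasurable F μ) {K : ℝ≥0∞}
    (h : ∀ u : X → ℝ≥0∞, AEMeasurable u μ → ∫⁻ x, u x ^ q ∂μ = 1 → ∫⁻ x, F x * u x ∂μ ≤ K) :
    (∫⁻ x, F x ^ p ∂μ) ^ (1 / p) ≤ K := by
  refine le_of_forall_lt fun c hc => ?_
  obtain ⟨d, hcd, hd⟩ := exists_between hc
  obtain ⟨u, hu, hu1, hcu⟩ := exists_dual_test hpq hF hd
  exact hcd.trans_le (hcu.trans (h u hu hu1))

/-- Landau's theorem. -/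
theorem lintegral_rpow_lt_top_of_forall_dual [SigmaFinite μ] (hpq : p.HolderConjugate q)
    {F : X → ℝ≥0∞} (hF : AEMeasurable F μ)
    (h : ∀ u : X → ℝ≥0∞, AEMeasurable u μ → ∫⁻ x, u x ^ q ∂μ < ∞ → ∫⁻ x, F x * u x ∂μ < ∞) :
    ∫⁻ x, F x ^ p ∂μ < ∞ := by
  have hq := hpq.symm.pos
  by_contra hinf
  rw [not_lt, top_le_iff] at hinf
  have hk : ∀ k : ℕ, ∃ u : X → ℝ≥0∞, AEMeasurable u μ ∧ ∫⁻ x, u x ^ q ∂μ = 1 ∧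
      (4 : ℝ≥0∞) ^ k ≤ ∫⁻ x, F x * u x ∂μ := by
    intro k
    refine exists_dual_test hpq hF ?_
    rw [hinf, ENNReal.top_rpow_of_pos hpq.one_div_pos]
    exact ENNReal.pow_lt_top (by simp)
  choose u hu hu1 huk using hk
  -- The test functions are superposed in ℓ^q with coefficients 2^{-k}: the integral of U^q is then
  -- a geometric series, while U ≥ 2^{-k} u_k pairs with F to at least 2^{-k} 4^k = 2^k.
  set ρ : ℝ≥0∞ := (2 : ℝ≥0∞)⁻¹ ^ q with hρ
  let U : X → ℝ≥0∞ := fun x => (∑' k : ℕ, ρ ^ k * u k x ^ q) ^ (1 / q)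
  have hUm : AEMeasurable U μ :=
    (AEMeasurable.tsum fun k => ((hu k).pow_const q).const_mul _).pow_const _
  have hUq : ∀ x, U x ^ q = ∑' k : ℕ, ρ ^ k * u k x ^ q := by
    intro x
    simp only [U]
    rw [← ENNReal.rpow_mul, one_div_mul_cancel hq.ne', ENNReal.rpow_one]
  have hUfin : ∫⁻ x, U x ^ q ∂μ < ∞ := by
    simp_rw [hUq]
    rw [lintegral_tsum fun k => ((hu k).pow_const q).const_mul _]
    simp_rw [lintegral_const_mul'' _ ((hu _).pow_const q), hu1, mul_one]
    rw [ENNReal.tsum_geometric]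
    have : ρ < 1 := ENNReal.rpow_lt_one (by simp) hq
    exact ENNReal.inv_lt_top.2 (tsub_pos_of_lt this)
  refine (h U hUm hUfin).ne (ENNReal.eq_top_of_forall_nnreal_le fun r => ?_)
  obtain ⟨k, hk⟩ := exists_nat_gt r
  have hkU : ∀ x, (2 : ℝ≥0∞)⁻¹ ^ k * u k x ≤ U x := by
    intro x
    have h1 : ρ ^ k * u k x ^ q ≤ U x ^ q := by
      rw [hUq]; exact ENNReal.le_tsum k
    have h2 : ρ ^ k * u k x ^ q = ((2 : ℝ≥0∞)⁻¹ ^ k * u k x) ^ q := by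
      rw [ENNReal.mul_rpow_of_nonneg _ _ hq.le, hρ, ← ENNReal.rpow_natCast,
        ← ENNReal.rpow_natCast, ← ENNReal.rpow_mul, ← ENNReal.rpow_mul, mul_comm q]
    rw [h2] at h1
    exact (ENNReal.rpow_le_rpow_iff hq).1 h1
  calc (r : ℝ≥0∞) ≤ (k : ℝ≥0∞) := by exact_mod_cast hk.le
    _ ≤ (2 : ℝ≥0∞) ^ k := by exact_mod_cast Nat.lt_two_pow_self.le
    _ = (2 : ℝ≥0∞)⁻¹ ^ k * 4 ^ k := by
        rw [← mul_pow, show (4 : ℝ≥0∞) = 2 * 2 by norm_num, ← mul_assoc,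
          ENNReal.inv_mul_cancel (by simp) (by simp), one_mul]
    _ ≤ (2 : ℝ≥0∞)⁻¹ ^ k * ∫⁻ x, F x * u k x ∂μ := by gcongr; exact huk k
    _ = ∫⁻ x, F x * ((2 : ℝ≥0∞)⁻¹ ^ k * u k x) ∂μ := by
        rw [← lintegral_const_mul' _ _ (by simp)]
        congr 1; ext x; ring
    _ ≤ ∫⁻ x, F x * U x ∂μ := by gcongr with x; exact hkU x

end Duality

/-- The test function is g = sgn(f) u v, for which f g = |f| v u. Where v vanishes so does g, and 0
· ∞ = 0 keeps |g|/v ≤ u. -/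
theorem exists_signed_test {p q : ℝ} (hpq : p.HolderConjugate q) {v f : ℝ → ℝ}
    (hv : AEMeasurable v (volume.restrict (Ioi 0)))
    (hf : AEMeasurable f (volume.restrict (Ioi 0))) {u : ℝ → ℝ≥0∞}
    (hu : AEMeasurable u (volume.restrict (Ioi 0)))
    (hfin : ∫⁻ x in Ioi (0 : ℝ), u x ^ q < ∞) :
    ∃ g : ℝ → ℝ, MemLw q (wtInv v) g ∧
      wNorm q (wtInv v) g ≤ (∫⁻ x in Ioi (0 : ℝ), u x ^ q) ^ (1 / q) ∧
      (∀ x, 0 ≤ f x * g x) ∧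
      ∫⁻ x in Ioi (0 : ℝ), ‖f x * g x‖ₑ = ∫⁻ x in Ioi (0 : ℝ), (wt v x * ‖f x‖ₑ) * u x := by
  have hq := hpq.symm.pos
  have hwt : AEMeasurable (wt v) (volume.restrict (Ioi 0)) := hv.ennreal_ofReal
  have hutop : ∀ᵐ x ∂(volume.restrict (Ioi (0 : ℝ))), u x < ∞ := by
    filter_upwards [ae_lt_top' (hu.pow_const q) hfin.ne] with x hx
    exact (ENNReal.rpow_lt_top_iff_of_pos hq).1 hx
  let g : ℝ → ℝ := fun x => f x * |f x|⁻¹ * ((u x).toReal * (wt v x).toReal)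
  have hle : ∀ x, wtInv v x * ‖g x‖ₑ ≤ u x := by
    intro x
    have h1 : ‖f x * |f x|⁻¹‖ₑ ≤ 1 := by
      rw [← ofReal_norm, ENNReal.ofReal_le_one, norm_mul, norm_inv, Real.norm_eq_abs,
        Real.norm_eq_abs, abs_abs]
      exact mul_inv_le_one
    have h2 : ‖(u x).toReal‖ₑ ≤ u x := by
      rw [Real.enorm_of_nonneg ENNReal.toReal_nonneg]; exact ENNReal.ofReal_toReal_le
    have h3 : ‖(wt v x).toReal‖ₑ ≤ wt v x := by
      rw [Real.enorm_of_nonneg ENNReal.toReal_nonneg]; exact ENNReal.ofReal_toReal_le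
    calc wtInv v x * ‖g x‖ₑ ≤ (wt v x)⁻¹ * (1 * (u x * wt v x)) := by
          simp only [g, enorm_mul _ (_ * _)]
          rw [enorm_mul ((u x).toReal)]
          gcongr
          exact le_rfl
      _ = u x * ((wt v x)⁻¹ * wt v x) := by ring
      _ ≤ u x * 1 := by gcongr; exact ENNReal.inv_mul_le_one _
      _ = u x := mul_one _
  have hN : wNorm q (wtInv v) g ≤ (∫⁻ x in Ioi (0 : ℝ), u x ^ q) ^ (1 / q) := by
    refine ENNReal.rpow_le_rpow (lintegral_mono fun x => ?_) hpq.symm.one_div_nonneg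
    exact ENNReal.rpow_le_rpow (hle x) hq.le
  have hfg : ∀ x, f x * g x = |f x| * ((u x).toReal * (wt v x).toReal) := by
    intro x
    simp only [g]
    rcases eq_or_ne (f x) 0 with h | h
    · simp [h]
    · have e : f x * (f x * |f x|⁻¹) = |f x| := by
        rw [← mul_assoc, ← abs_mul_abs_self, mul_assoc, mul_inv_cancel₀ (abs_ne_zero.2 h), mul_one]
      rw [← mul_assoc, e]
  refine ⟨g, ⟨?_, hN.trans_lt ?_⟩, hN, fun x => ?_, ?_⟩
  · exact (hf.mul hf.abs.inv).mul (hu.ennreal_toReal.mul hwt.ennreal_toReal)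
  · exact ENNReal.rpow_lt_top_of_nonneg hpq.symm.one_div_nonneg hfin.ne
  · rw [hfg]; positivity
  · refine lintegral_congr_ae ?_
    filter_upwards [hutop] with x hx
    rw [hfg, enorm_mul, enorm_mul, Real.enorm_abs, Real.enorm_of_nonneg ENNReal.toReal_nonneg,
      Real.enorm_of_nonneg ENNReal.toReal_nonneg, ENNReal.ofReal_toReal hx.ne,
      ENNReal.ofReal_toReal (by simp [wt])]
    ring

/-- If `L^q_{1/v} ⊂ X` with norm at most `C`, then `𝔇_X ⊂ L^p_v` with the corresponding bound. -/
theorem memLw_and_wNorm_le_weakJ {p q : ℝ} (hpq : p.HolderConjugate q) {v : ℝ → ℝ}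
    (hv : AEMeasurable v (volume.restrict (Ioi 0))) {X : (ℝ → ℝ) → Prop}
    {N : (ℝ → ℝ) → ℝ≥0∞} {C : ℝ} (hC : 0 < C)
    (hX : ∀ g, MemLw q (wtInv v) g → X g ∧ N g ≤ ENNReal.ofReal C * wNorm q (wtInv v) g)
    {f : ℝ → ℝ} (hf : MemD X f) :
    MemLw p (wt v) f ∧ wNorm p (wt v) f ≤ ENNReal.ofReal C * weakJ X N f := by
  have hF : AEMeasurable (fun x => wt v x * ‖f x‖ₑ) (volume.restrict (Ioi 0)) :=
    hv.ennreal_ofReal.mul hf.aemeasurable.enorm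
  refine ⟨⟨hf.aemeasurable, ?_⟩, ?_⟩
  · refine ENNReal.rpow_lt_top_of_nonneg hpq.one_div_nonneg (ne_of_lt ?_)
    -- `weakJ` may be infinite, so finiteness of the norm does not follow from the bound; Landau's
    -- theorem supplies it.
    refine lintegral_rpow_lt_top_of_forall_dual hpq hF fun u hu hfin => ?_
    obtain ⟨g, hg, -, -, hfg⟩ := exists_signed_test hpq hv hf.aemeasurable hu hfin
    rw [← hfg]
    exact hf.lintegral_lt_top g (hX g hg).1
  · refine lintegral_rpow_le_of_forall_dual hpq hF fun u hu hu1 => ?_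
    obtain ⟨g, hg, hgN, hpos, hfg⟩ := exists_signed_test hpq hv hf.aemeasurable hu
      (hu1.trans_lt ENNReal.one_lt_top)
    rw [hu1, ENNReal.one_rpow] at hgN
    rw [← hfg]
    -- Null functions are excluded from the supremum, but they pair to zero with f.
    by_cases hg0 : g =ᵐ[volume.restrict (Ioi 0)] 0
    · have : ∫⁻ x in Ioi (0 : ℝ), ‖f x * g x‖ₑ = 0 := by
        rw [← lintegral_zero (μ := volume.restrict (Ioi (0 : ℝ)))]
        refine lintegral_congr_ae ?_
        filter_upwards [hg0] with x hx
        simp [hx]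
      rw [this]; exact bot_le
    · have hNg : N g ≤ ENNReal.ofReal C := by
        refine (hX g hg).2.trans ?_
        calc _ ≤ ENNReal.ofReal C * 1 := by gcongr
          _ = _ := mul_one _
      have hI : ‖∫ x in Ioi (0 : ℝ), f x * g x‖ₑ = ∫⁻ x in Ioi (0 : ℝ), ‖f x * g x‖ₑ := by
        rw [integral_eq_lintegral_of_nonneg_ae (ae_of_all _ hpos)
          (hf.aemeasurable.mul hg.aemeasurable).aestronglyMeasurable,
          Real.enorm_of_nonneg ENNReal.toReal_nonneg]
        have : ∀ x, ENNReal.ofReal (f x * g x) = ‖f x * g x‖ₑ := fun x =>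
          (Real.enorm_of_nonneg (hpos x)).symm
        simp_rw [this]
        exact ENNReal.ofReal_toReal (hf.lintegral_lt_top g (hX g hg).1).ne
      have hJ : ‖∫ x in Ioi (0 : ℝ), f x * g x‖ₑ / N g ≤ weakJ X N f :=
        le_iSup_of_le g (le_iSup_of_le (hX g hg).1 (le_iSup_of_le hg0 le_rfl))
      rw [hI] at hJ
      have h2 : (∫⁻ x in Ioi (0 : ℝ), ‖f x * g x‖ₑ) / ENNReal.ofReal C ≤ weakJ X N f :=
        (ENNReal.div_le_div_left hNg _).trans hJ
      rw [ENNReal.div_le_iff_le_mul (Or.inl (by simpa using hC)) (Or.inl (by simp))] at h2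
      rwa [mul_comm]

variable {p : ℝ} {v₀ v₁ : ℝ → ℝ}

/-! ### Existence of the pair (a(t), b(t)) -/

section Existence

variable {φ : ℝ → ℝ≥0∞} {m : ℝ → ℝ}

theorem setLIntegral_Ioo_lt_top_of_primitive_bddBelow
    (hm : ∀ α β, 0 < α → α ≤ β → ∫⁻ x in Ioo α β, φ x = ENNReal.ofReal (m β - m α))
    (hb : ¬ ∀ L, ∃ x, 0 < x ∧ m x < L) {c : ℝ} (hc : 0 < c) : ∫⁻ x in Ioo 0 c, φ x < ∞ := by
  push Not at hb
  obtain ⟨L, hL⟩ := hb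
  refine (setLIntegral_Ioo_zero_le hc (C := ENNReal.ofReal (m c - L)) fun α hα hαc => ?_).trans_lt
    ENNReal.ofReal_lt_top
  rw [hm α c hα hαc.le]
  exact ENNReal.ofReal_le_ofReal (by linarith [hL α hα])

theorem setLIntegral_Ioi_lt_top_of_primitive_bddAbove
    (hm : ∀ α β, 0 < α → α ≤ β → ∫⁻ x in Ioo α β, φ x = ENNReal.ofReal (m β - m α))
    (hb : ¬ ∀ L, ∃ x, 0 < x ∧ L < m x) {c : ℝ} (hc : 0 < c) : ∫⁻ x in Ioi c, φ x < ∞ := by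
  push Not at hb
  obtain ⟨L, hL⟩ := hb
  refine (setLIntegral_le_of_forall_Ioo_left (C := ENNReal.ofReal (L - m c)) (fun y hy => hy)
    (fun y _ => fun x hx => hx.1) fun y hy => ?_).trans_lt ENNReal.ofReal_lt_top
  have hy : c < y := hy
  rw [hm c y hc hy.le]
  exact ENNReal.ofReal_le_ofReal (by linarith [hL y (hc.trans hy)])

theorem lrNorm_lt_top {r : ℝ} (hr : 0 < r) {s : Set ℝ} {h : ℝ → ℝ≥0∞}
    (hs : ∫⁻ x in s, h x ^ r < ∞) : lrNorm r s h < ∞ :=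
  ENNReal.rpow_lt_top_of_nonneg (by positivity) hs.ne

theorem IsWeight.aemeasurable_wt {r : ℝ} {v : ℝ → ℝ} (h : IsWeight r v) :
    AEMeasurable (wt v) (volume.restrict (Ioi 0)) := h.aemeasurable.ennreal_ofReal

theorem IsWeight.aemeasurable_wtInv {r : ℝ} {v : ℝ → ℝ} (h : IsWeight r v) :
    AEMeasurable (wtInv v) (volume.restrict (Ioi 0)) := h.aemeasurable_wt.inv

/-- As v₁ is finite everywhere, 1/v₁ never vanishes. This makes the primitive of v₁^{-p'} strictly
increasing. -/
theorem massInv_ne_zero (hp : 1 < p) (h₁ : IsWeight p v₁) {α β : ℝ} (hα : 0 < α) (hαβ : α < β) :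
    massInv p v₁ α β ≠ 0 := by
  have hq := (Real.HolderConjugate.conjExponent hp).symm.pos
  intro h
  have hsub : Ioo α β ⊆ Ioi 0 := fun x hx => hα.trans hx.1
  rw [massInv, lintegral_eq_zero_iff' ((h₁.aemeasurable_wtInv.mono_measure
    (Measure.restrict_mono hsub le_rfl)).pow_const _)] at h
  have hF : ∀ᵐ x ∂(volume.restrict (Ioo α β)), False := by
    filter_upwards [h] with x hx
    have hx : wtInv v₁ x ^ p.conjExponent = 0 := hx
    rw [ENNReal.rpow_eq_zero_iff_of_pos hq] at hx
    exact ENNReal.inv_ne_zero.2 ENNReal.ofReal_ne_top hx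
  rw [ae_iff] at hF
  simp only [not_false_eq_true, ofPred_true, Measure.restrict_apply_univ, Real.volume_Ioo,
    ENNReal.ofReal_eq_zero] at hF
  linarith

theorem exists_mass_primitive (hp : 1 < p) (h₁ : IsWeight p v₁)
    (hloc : LocLr p.conjExponent (wtInv v₁)) :
    ∃ m : ℝ → ℝ, ContinuousOn m (Ioi 0) ∧ StrictMonoOn m (Ioi 0) ∧
      ∀ α β, 0 < α → α ≤ β → massInv p v₁ α β = ENNReal.ofReal (m β - m α) := by
  obtain ⟨m, hmc, -, hm⟩ := exists_primitive (h₁.aemeasurable_wtInv.pow_const _) hloc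
  refine ⟨m, hmc, fun α hα β _ hαβ => ?_, hm⟩
  have := massInv_ne_zero hp h₁ hα hαβ
  rw [massInv, hm α β hα hαβ.le] at this
  simpa using this

/-- If the primitives of v₁^{-p'} and v₀^p were both bounded at an endpoint, both norms there would
be finite, against the divergence condition. So one of them diverges at each end, which is what
`exists_balanced` needs. -/
theorem isBalancedPair_balancedPair (hp : 1 < p) (h₀ : IsWeight p v₀) (h₁ : IsWeight p v₁)
    (hloc : LocLr p.conjExponent (wtInv v₁)) (hdiv : DivergenceCondition p v₀ v₁) {t : ℝ}
    (ht : 0 < t) : IsBalancedPair p v₀ v₁ t (aFun p v₀ v₁ t, bFun p v₀ v₁ t) := by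
  have hpq := Real.HolderConjugate.conjExponent hp
  have hp0 := hpq.pos
  have hq0 := hpq.symm.pos
  obtain ⟨m, hmc, hms, hm⟩ := exists_mass_primitive hp h₁ hloc
  obtain ⟨n, hnc, hnm, hn⟩ := exists_primitive (h₀.aemeasurable_wt.pow_const p) h₀.locLr
  obtain ⟨c, hc, hc0, hc1⟩ := hdiv
  have hne : ∃ α β, 0 < α ∧ α < β ∧ n α < n β := by
    by_contra hcon
    push Not at hcon
    have hz : ∫⁻ x in Ioi (0 : ℝ), wt v₀ x ^ p ≤ 0 := by
      refine setLIntegral_le_of_forall_Ioo_left (fun y hy => hy) (fun y _ => fun x hx => hx.1)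
        fun y hy => setLIntegral_Ioo_zero_le hy fun α hα hαy => ?_
      rw [hn α y hα hαy.le, ENNReal.ofReal_of_nonpos (by linarith [hcon α y hα hαy])]
    rw [nonpos_iff_eq_zero, lintegral_eq_zero_iff' (h₀.aemeasurable_wt.pow_const p)] at hz
    refine h₀.ne_zero ?_
    rw [lintegral_eq_zero_iff' h₀.aemeasurable_wt]
    filter_upwards [hz] with x hx
    exact (ENNReal.rpow_eq_zero_iff_of_pos hp0).1 hx
  have hb0 : (∀ L, ∃ x, 0 < x ∧ m x < L) ∨ ∀ L, ∃ x, 0 < x ∧ n x < L := by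
    by_contra hcon
    rw [not_or] at hcon
    exact (ENNReal.mul_lt_top
      (lrNorm_lt_top hq0 (setLIntegral_Ioo_lt_top_of_primitive_bddBelow hm hcon.1 hc))
      (lrNorm_lt_top hp0 (setLIntegral_Ioo_lt_top_of_primitive_bddBelow hn hcon.2 hc))).ne hc0
  have hb1 : (∀ L, ∃ x, 0 < x ∧ L < m x) ∨ ∀ L, ∃ x, 0 < x ∧ L < n x := by
    by_contra hcon
    rw [not_or] at hcon
    exact (ENNReal.mul_lt_top
      (lrNorm_lt_top hq0 (setLIntegral_Ioi_lt_top_of_primitive_bddAbove hm hcon.1 hc))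
      (lrNorm_lt_top hp0 (setLIntegral_Ioi_lt_top_of_primitive_bddAbove hn hcon.2 hc))).ne hc1
  obtain ⟨a, b, ha, hat, htb, heq, hprod⟩ :=
    exists_balanced hms hnm hmc hnc hpq.sub_one_pos hne hb0 hb1 ht
  have hex : ∃ z, IsBalancedPair p v₀ v₁ t z := by
    refine ⟨(a, b), ha, hat, htb, ?_, ?_⟩
    · rw [hm a t ha hat.le, hm t b ht htb.le, heq]
    · have hab := (hat.trans htb).le
      have hmab : 0 ≤ m b - m a := sub_nonneg.2 (hms.monotoneOn ha (ha.trans_le hab) hab)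
      rw [lrNorm, hn a b ha hab, hm a b ha hab]
      have e1 : 1 / p.conjExponent = (p - 1) * (1 / p) := by
        rw [Real.conjExponent]; field_simp
      rw [e1, ENNReal.rpow_mul, ← ENNReal.mul_rpow_of_nonneg _ _ hpq.one_div_nonneg,
        ENNReal.ofReal_rpow_of_nonneg hmab hpq.sub_one_pos.le,
        ← ENNReal.ofReal_mul (Real.rpow_nonneg hmab _), hprod, ENNReal.ofReal_one,
        ENNReal.one_rpow]
  exact Classical.epsilon_spec hex

end Existence

/-! ### Monotonicity of a and b, and near monotonicity of V₁ -/

section Monotonicity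

/-- The p-th power of the balance condition, using p/p' = p - 1. -/
theorem IsBalancedPair.mass_rpow_mul {t : ℝ} (hp : 1 < p) {z : ℝ × ℝ}
    (h : IsBalancedPair p v₀ v₁ t z) :
    massInv p v₁ z.1 z.2 ^ (p - 1) * ∫⁻ x in Ioo z.1 z.2, wt v₀ x ^ p = 1 := by
  have hpq := Real.HolderConjugate.conjExponent hp
  have := congrArg (· ^ p) h.2.2.2.2
  simp only [lrNorm, ENNReal.one_rpow] at this
  rwa [ENNReal.mul_rpow_of_nonneg _ _ hpq.nonneg, ← ENNReal.rpow_mul, ← ENNReal.rpow_mul,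
    one_div_mul_cancel hpq.ne_zero, ENNReal.rpow_one, one_div_mul_eq_div,
    hpq.div_conj_eq_sub_one] at this

theorem IsBalancedPair.mass_ne_zero {t : ℝ} (hp : 1 < p) {z : ℝ × ℝ}
    (h : IsBalancedPair p v₀ v₁ t z) : massInv p v₁ z.1 z.2 ≠ 0 := by
  intro h0
  have := h.mass_rpow_mul hp
  rw [h0, ENNReal.zero_rpow_of_pos (by linarith), zero_mul] at this
  exact zero_ne_one this

theorem IsBalancedPair.mass_ne_top {t : ℝ} (hp : 1 < p) {z : ℝ × ℝ}
    (h : IsBalancedPair p v₀ v₁ t z) : massInv p v₁ z.1 z.2 ≠ ∞ := by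
  intro h0
  have := h.mass_rpow_mul hp
  rw [h0, ENNReal.top_rpow_of_pos (by linarith), ENNReal.top_mul'] at this
  split_ifs at this <;> simp at this

/-- The balance product is always 1, so a larger interval, with its larger v₀-mass, cannot have the
larger v₁-mass. -/
theorem IsBalancedPair.mass_le_of_subset {s t : ℝ} (hp : 1 < p) {z w : ℝ × ℝ}
    (hz : IsBalancedPair p v₀ v₁ s z) (hw : IsBalancedPair p v₀ v₁ t w)
    (hsub : Ioo z.1 z.2 ⊆ Ioo w.1 w.2) : massInv p v₁ w.1 w.2 ≤ massInv p v₁ z.1 z.2 := by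
  have e1 := hz.mass_rpow_mul hp
  have e2 := hw.mass_rpow_mul hp
  have hle : ∫⁻ x in Ioo z.1 z.2, wt v₀ x ^ p ≤ ∫⁻ x in Ioo w.1 w.2, wt v₀ x ^ p :=
    lintegral_mono_set hsub
  set N := ∫⁻ x in Ioo w.1 w.2, wt v₀ x ^ p
  have hN0 : N ≠ 0 := by rintro h; rw [h, mul_zero] at e2; exact zero_ne_one e2
  have hNt : N ≠ ∞ := by
    rintro h
    rw [h, ENNReal.mul_top'] at e2
    split_ifs at e2 <;> simp at e2
  have h3 : massInv p v₁ w.1 w.2 ^ (p - 1) * N ≤ massInv p v₁ z.1 z.2 ^ (p - 1) * N := by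
    rw [e2, ← e1]; gcongr
  rw [ENNReal.mul_le_mul_iff_left hN0 hNt] at h3
  exact (ENNReal.rpow_le_rpow_iff (by linarith)).1 h3

/-- If one endpoint failed to move right, reflection about the new centre would make one interval
contain the other, with strictly larger v₁-mass. This contradicts `mass_le_of_subset`. -/
theorem IsBalancedPair.strictMono (hp : 1 < p) (h₁ : IsWeight p v₁)
    (hloc : LocLr p.conjExponent (wtInv v₁)) {x y : ℝ} {z w : ℝ × ℝ} (hxy : x < y)
    (hz : IsBalancedPair p v₀ v₁ x z) (hw : IsBalancedPair p v₀ v₁ y w) :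
    z.1 < w.1 ∧ z.2 < w.2 := by
  obtain ⟨m, -, hms, hm⟩ := exists_mass_primitive hp h₁ hloc
  obtain ⟨hz1, hz2, hz3, hz4, -⟩ := id hz
  obtain ⟨hw1, hw2, hw3, hw4, -⟩ := id hw
  have hx : 0 < x := hz1.trans hz2
  have hy : 0 < y := hw1.trans hw2
  have hz0 : 0 < z.2 := hx.trans hz3
  have hw0 : 0 < w.2 := hy.trans hw3
  have ez : m x - m z.1 = m z.2 - m x := by
    rw [hm _ _ hz1 hz2.le, hm _ _ hx hz3.le] at hz4
    exact (ENNReal.ofReal_eq_ofReal_iff (sub_pos.2 (hms hz1 hx hz2)).le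
      (sub_pos.2 (hms hx hz0 hz3)).le).1 hz4
  have ew : m y - m w.1 = m w.2 - m y := by
    rw [hm _ _ hw1 hw2.le, hm _ _ hy hw3.le] at hw4
    exact (ENNReal.ofReal_eq_ofReal_iff (sub_pos.2 (hms hw1 hy hw2)).le
      (sub_pos.2 (hms hy hw0 hw3)).le).1 hw4
  have hmxy := hms hx hy hxy
  constructor
  · by_contra! hcon
    have hc := hms.monotoneOn hw1 hz1 hcon
    have hb : z.2 < w.2 := by rw [← hms.lt_iff_lt hz0 hw0]; linarith
    have := hz.mass_le_of_subset hp hw (Ioo_subset_Ioo hcon hb.le)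
    rw [hm _ _ hz1 (hz2.trans hz3).le, hm _ _ hw1 (hw2.trans hw3).le,
      ENNReal.ofReal_le_ofReal_iff (sub_pos.2 (hms hz1 hz0 (hz2.trans hz3))).le] at this
    linarith [hms hz0 hw0 hb]
  · by_contra! hcon
    have hc := hms.monotoneOn hw0 hz0 hcon
    have ha : z.1 < w.1 := by rw [← hms.lt_iff_lt hz1 hw1]; linarith
    have := hw.mass_le_of_subset hp hz (Ioo_subset_Ioo ha.le hcon)
    rw [hm _ _ hz1 (hz2.trans hz3).le, hm _ _ hw1 (hw2.trans hw3).le,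
      ENNReal.ofReal_le_ofReal_iff (sub_pos.2 (hms hw1 hw0 (hw2.trans hw3))).le] at this
    linarith [hms hz1 hw1 ha]

theorem IsBalancedPair.mass_eq_two_mul (hp : 1 < p) (h₁ : IsWeight p v₁)
    (hloc : LocLr p.conjExponent (wtInv v₁)) {x : ℝ} {z : ℝ × ℝ}
    (hz : IsBalancedPair p v₀ v₁ x z) :
    massInv p v₁ z.1 z.2 = 2 * massInv p v₁ x z.2 := by
  obtain ⟨m, -, hms, hm⟩ := exists_mass_primitive hp h₁ hloc
  obtain ⟨hz1, hz2, hz3, hz4, -⟩ := hz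
  have hx : 0 < x := hz1.trans hz2
  have h1 := sub_pos.2 (hms hz1 hx hz2)
  have h2 := sub_pos.2 (hms hx (hx.trans hz3) hz3)
  rw [two_mul]
  nth_rewrite 2 [← hz4]
  rw [hm _ _ hz1 (hz2.trans hz3).le, hm _ _ hz1 hz2.le, hm _ _ hx hz3.le,
    ← ENNReal.ofReal_add h2.le h1.le]
  congr 1; ring

/-- `V₁` is almost increasing on windows. -/
theorem IsBalancedPair.mass_le_two_mul (hp : 1 < p) (h₁ : IsWeight p v₁)
    (hloc : LocLr p.conjExponent (wtInv v₁)) {x y : ℝ} {z w : ℝ × ℝ} (hxy : x < y)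
    (hz : IsBalancedPair p v₀ v₁ x z) (hw : IsBalancedPair p v₀ v₁ y w) (hwx : w.1 < x) :
    massInv p v₁ z.1 z.2 ≤ 2 * massInv p v₁ w.1 w.2 := by
  -- Half of the mass at x lies on the right half (x, b(x)), which is contained in (a(y), b(y)).
  rw [hz.mass_eq_two_mul hp h₁ hloc]
  gcongr
  exact lintegral_mono_set (Ioo_subset_Ioo hwx.le (hz.strictMono hp h₁ hloc hxy hw).2.le)

end Monotonicity

/-! ### Windows: measurability and the local weight estimate -/

/-- The standing assumptions: `(a(t), b(t))` is balanced for every `t > 0`. -/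
structure Balanced (p : ℝ) (v₀ v₁ : ℝ → ℝ) : Prop where
  one_lt : 1 < p
  weight₀ : IsWeight p v₀
  weight₁ : IsWeight p v₁
  loc : LocLr p.conjExponent (wtInv v₁)
  pair : ∀ t, 0 < t → IsBalancedPair p v₀ v₁ t (aFun p v₀ v₁ t, bFun p v₀ v₁ t)

namespace Balanced

theorem conj (h : Balanced p v₀ v₁) : p.HolderConjugate p.conjExponent :=
  Real.HolderConjugate.conjExponent h.one_lt

theorem aFun_pos (h : Balanced p v₀ v₁) {t : ℝ} (ht : 0 < t) : 0 < aFun p v₀ v₁ t :=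
  (h.pair t ht).1

theorem strictMonoOn_aFun (h : Balanced p v₀ v₁) : StrictMonoOn (aFun p v₀ v₁) (Ioi 0) :=
  fun x hx y hy hxy =>
    ((h.pair x hx).strictMono h.one_lt h.weight₁ h.loc hxy (h.pair y hy)).1

theorem strictMonoOn_bFun (h : Balanced p v₀ v₁) : StrictMonoOn (bFun p v₀ v₁) (Ioi 0) :=
  fun x hx y hy hxy =>
    ((h.pair x hx).strictMono h.one_lt h.weight₁ h.loc hxy (h.pair y hy)).2

theorem V1_ne_zero (h : Balanced p v₀ v₁) {t : ℝ} (ht : 0 < t) : V1 p v₀ v₁ t ≠ 0 :=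
  (h.pair t ht).mass_ne_zero h.one_lt

theorem V1_ne_top (h : Balanced p v₀ v₁) {t : ℝ} (ht : 0 < t) : V1 p v₀ v₁ t ≠ ∞ :=
  (h.pair t ht).mass_ne_top h.one_lt

theorem V1_rpow_mul (h : Balanced p v₀ v₁) {t : ℝ} (ht : 0 < t) :
    V1 p v₀ v₁ t ^ (p - 1) * ∫⁻ x in Ioo (aFun p v₀ v₁ t) (bFun p v₀ v₁ t), wt v₀ x ^ p = 1 :=
  (h.pair t ht).mass_rpow_mul h.one_lt

theorem V1_le_two_mul (h : Balanced p v₀ v₁) {x y : ℝ} (hx : 0 < x)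
    (hy : y ∈ window (aFun p v₀ v₁) x) : V1 p v₀ v₁ x ≤ 2 * V1 p v₀ v₁ y :=
  (h.pair x hx).mass_le_two_mul h.one_lt h.weight₁ h.loc hy.1
    (h.pair y (hx.trans hy.1)) hy.2

theorem massInv_aFun_le_V1 (h : Balanced p v₀ v₁) {x t : ℝ} (hx : 0 < x) (htx : t ≤ x) :
    massInv p v₁ (aFun p v₀ v₁ x) t ≤ V1 p v₀ v₁ x :=
  lintegral_mono_set (Ioo_subset_Ioo_right (htx.trans (h.pair x hx).2.2.1.le))

theorem Ioo_subset_window (h : Balanced p v₀ v₁) {t y : ℝ} (ht : 0 < t)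
    (hy : y ∈ window (aFun p v₀ v₁) t) : Ioo t y ⊆ window (aFun p v₀ v₁) t := fun _ hx =>
  ⟨hx.1, (h.strictMonoOn_aFun (ht.trans hx.1) (ht.trans hy.1) hx.2).trans hy.2⟩

/-- With m a primitive of v₁^{-p'}, V₁ is the difference of the monotone functions m ∘ b and m ∘ a.
-/
theorem aemeasurable_V1 (h : Balanced p v₀ v₁) :
    AEMeasurable (V1 p v₀ v₁) (volume.restrict (Ioi 0)) := by
  obtain ⟨m, -, hms, hm⟩ := exists_mass_primitive h.one_lt h.weight₁ h.loc
  have hb : MonotoneOn (fun x => m (bFun p v₀ v₁ x)) (Ioi 0) := fun x hx y hy hxy =>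
    hms.monotoneOn (lt_trans hx (h.pair x hx).2.2.1) (lt_trans hy (h.pair y hy).2.2.1)
      (h.strictMonoOn_bFun.monotoneOn hx hy hxy)
  have ha : MonotoneOn (fun x => m (aFun p v₀ v₁ x)) (Ioi 0) := fun x hx y hy hxy =>
    hms.monotoneOn (h.aFun_pos hx) (h.aFun_pos hy) (h.strictMonoOn_aFun.monotoneOn hx hy hxy)
  refine (((aemeasurable_restrict_of_monotoneOn measurableSet_Ioi hb).sub
    (aemeasurable_restrict_of_monotoneOn measurableSet_Ioi ha)).ennreal_ofReal).congr ?_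
  filter_upwards [self_mem_ae_restrict measurableSet_Ioi] with x hx
  have hx : 0 < x := hx
  exact (hm _ _ (h.aFun_pos hx) ((h.pair x hx).2.1.trans (h.pair x hx).2.2.1).le).symm

/-- Only the values of a on (0,∞) are controlled; extended by zero, a is monotone on the whole line
because it is positive there. -/
theorem measurable_indicator_aFun (h : Balanced p v₀ v₁) :
    Measurable ((Ioi (0 : ℝ)).indicator (aFun p v₀ v₁)) := by
  refine Monotone.measurable fun x y hxy => ?_
  by_cases hx : 0 < x
  · have hy := hx.trans_le hxy
    rw [indicator_of_mem (mem_Ioi.2 hx), indicator_of_mem (mem_Ioi.2 hy)]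
    exact h.strictMonoOn_aFun.monotoneOn hx hy hxy
  · rw [indicator_of_notMem (by simpa using hx)]
    exact indicator_nonneg (fun z hz => (h.aFun_pos hz).le) y

theorem measurableSet_windows (h : Balanced p v₀ v₁) :
    MeasurableSet {z : ℝ × ℝ | z.1 < z.2 ∧ (Ioi (0 : ℝ)).indicator (aFun p v₀ v₁) z.2 < z.1} :=
  (measurableSet_lt measurable_fst measurable_snd).inter
    (measurableSet_lt (h.measurable_indicator_aFun.comp measurable_snd) measurable_fst)

theorem mem_window_iff {t : ℝ} (ht : 0 < t) (x : ℝ) :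
    x ∈ window (aFun p v₀ v₁) t ↔
      (t, x) ∈ {z : ℝ × ℝ | z.1 < z.2 ∧ (Ioi (0 : ℝ)).indicator (aFun p v₀ v₁) z.2 < z.1} := by
  simp only [window, mem_ofPred_eq]
  refine and_congr_right fun htx => ?_
  rw [indicator_of_mem (mem_Ioi.2 (ht.trans htx))]

theorem measurableSet_window (h : Balanced p v₀ v₁) {t : ℝ} (ht : 0 < t) :
    MeasurableSet (window (aFun p v₀ v₁) t) := by
  have : window (aFun p v₀ v₁) t = Prod.mk t ⁻¹'
      {z : ℝ × ℝ | z.1 < z.2 ∧ (Ioi (0 : ℝ)).indicator (aFun p v₀ v₁) z.2 < z.1} :=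
    Set.ext fun x => mem_window_iff ht x
  rw [this]
  exact measurable_prodMk_left h.measurableSet_windows

theorem window_subset_Ioi {a : ℝ → ℝ} {t : ℝ} (ht : 0 < t) : window a t ⊆ Ioi 0 :=
  fun _ hx => ht.trans hx.1

/-- On (t, y) with y in the window, V₁ ≤ 2 V₁(y). Since (t, y) lies in (a(y), b(y)), balance at y
bounds the integral by 2^{p-1}, uniformly in y. -/
theorem setLIntegral_window_le (h : Balanced p v₀ v₁) {t : ℝ} (ht : 0 < t) :
    ∫⁻ x in window (aFun p v₀ v₁) t, wt v₀ x ^ p * V1 p v₀ v₁ x ^ (p - 1) ≤ 2 ^ (p - 1) := by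
  have hp := h.conj.sub_one_pos
  refine setLIntegral_le_of_forall_Ioo_left (fun y hy => hy.1)
    (fun y hy => h.Ioo_subset_window ht hy) fun y hy => ?_
  have hy0 : 0 < y := ht.trans hy.1
  have hfin : (2 * V1 p v₀ v₁ y) ^ (p - 1) ≠ ∞ :=
    ENNReal.rpow_ne_top_of_nonneg hp.le (ENNReal.mul_ne_top (by simp) (h.V1_ne_top hy0))
  calc ∫⁻ x in Ioo t y, wt v₀ x ^ p * V1 p v₀ v₁ x ^ (p - 1)
      ≤ ∫⁻ x in Ioo t y, wt v₀ x ^ p * (2 * V1 p v₀ v₁ y) ^ (p - 1) := by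
        refine setLIntegral_mono' measurableSet_Ioo fun x hx => ?_
        gcongr
        exact h.V1_le_two_mul (ht.trans hx.1) ⟨hx.2, hy.2.trans hx.1⟩
    _ = (∫⁻ x in Ioo t y, wt v₀ x ^ p) * (2 * V1 p v₀ v₁ y) ^ (p - 1) :=
        lintegral_mul_const' _ _ hfin
    _ ≤ (∫⁻ x in Ioo (aFun p v₀ v₁ y) (bFun p v₀ v₁ y), wt v₀ x ^ p) *
          (2 * V1 p v₀ v₁ y) ^ (p - 1) := by
        gcongr
        · exact hy.2.le
        · exact (h.pair y hy0).2.2.1.le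
    _ = 2 ^ (p - 1) * (V1 p v₀ v₁ y ^ (p - 1) *
          ∫⁻ x in Ioo (aFun p v₀ v₁ y) (bFun p v₀ v₁ y), wt v₀ x ^ p) := by
        rw [ENNReal.mul_rpow_of_nonneg _ _ hp.le]; ring
    _ = 2 ^ (p - 1) := by rw [h.V1_rpow_mul hy0, mul_one]

/-! ### Hölder's inequality and the Hardy–Steklov operator -/

/-- Where the weight vanishes, its reciprocal is ∞, and finiteness forces g = 0. -/
theorem enorm_le_of_mul_lt_top {v g : ℝ → ℝ} {x : ℝ} (hx : wtInv v x * ‖g x‖ₑ < ∞) :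
    ‖g x‖ₑ ≤ wtInv v x * ‖g x‖ₑ * wt v x := by
  by_cases h0 : wt v x = 0
  · have h1 : wtInv v x = ∞ := by
      change (wt v x)⁻¹ = ∞
      rw [h0, ENNReal.inv_zero]
    have h2 : ‖g x‖ₑ = 0 := by
      by_contra hne
      rw [h1, ENNReal.top_mul hne] at hx
      exact lt_irrefl _ hx
    simp [h2]
  · have h1 : wtInv v x * wt v x = 1 := ENNReal.inv_mul_cancel h0 ENNReal.ofReal_ne_top
    rw [mul_right_comm, h1, one_mul]

theorem ae_lt_top_of_memLw {r : ℝ} (hr : 0 < r) {v g : ℝ → ℝ} (hw : IsWeight p v)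
    (hg : MemLw r (wtInv v) g) :
    ∀ᵐ x ∂(volume.restrict (Ioi (0 : ℝ))), wtInv v x * ‖g x‖ₑ < ∞ := by
  have h1 : ∫⁻ x in Ioi (0 : ℝ), (wtInv v x * ‖g x‖ₑ) ^ r < ∞ := by
    have := hg.norm_lt_top
    rwa [wNorm, lrNorm, ENNReal.rpow_lt_top_iff_of_pos (by positivity)] at this
  filter_upwards [ae_lt_top' ((hw.aemeasurable_wtInv.mul hg.aemeasurable.enorm).pow_const r)
    h1.ne] with x hx
  exact (ENNReal.rpow_lt_top_iff_of_pos hr).1 hx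

/-- Hölder's inequality on a window. -/
theorem setLIntegral_window_rpow_le (h : Balanced p v₀ v₁) {g : ℝ → ℝ}
    (hg : MemLw p.conjExponent (wtInv v₀) g) {t : ℝ} (ht : 0 < t) :
    (∫⁻ x in window (aFun p v₀ v₁) t, ‖g x‖ₑ) ^ p.conjExponent ≤
      2 * ∫⁻ x in window (aFun p v₀ v₁) t,
        (wtInv v₀ x * ‖g x‖ₑ) ^ p.conjExponent * (V1 p v₀ v₁ x)⁻¹ := by
  have hpq := h.conj
  set q := p.conjExponent with hqdef
  have hq := hpq.symm.pos
  set W := window (aFun p v₀ v₁) t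
  set V := V1 p v₀ v₁
  have hres : volume.restrict W ≤ volume.restrict (Ioi 0) :=
    Measure.restrict_mono (window_subset_Ioi ht) le_rfl
  have hmem := self_mem_ae_restrict (μ := volume) (h.measurableSet_window ht)
  -- The split by V₁^{1/q} is chosen so that B^p = v₀^p V₁^{p-1}, the integrand of
  -- `setLIntegral_window_le`.
  set A : ℝ → ℝ≥0∞ := fun x => wtInv v₀ x * ‖g x‖ₑ * (V x ^ (1 / q))⁻¹
  set B : ℝ → ℝ≥0∞ := fun x => wt v₀ x * V x ^ (1 / q)
  have hVm : AEMeasurable (fun x => V x ^ (1 / q)) (volume.restrict W) :=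
    (h.aemeasurable_V1.mono_measure hres).pow_const _
  have hA : AEMeasurable A (volume.restrict W) :=
    ((h.weight₀.aemeasurable_wtInv.mul hg.aemeasurable.enorm).mono_measure hres).mul hVm.inv
  have hB : AEMeasurable B (volume.restrict W) :=
    (h.weight₀.aemeasurable_wt.mono_measure hres).mul hVm
  have h1 : ∫⁻ x in W, ‖g x‖ₑ ≤ ∫⁻ x in W, (B * A) x := by
    refine lintegral_mono_ae ?_
    filter_upwards [hmem, ae_mono hres (ae_lt_top_of_memLw hq h.weight₀ hg)] with x hxW hx
    have hx0 : 0 < x := window_subset_Ioi ht hxW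
    have hV0 : V x ^ (1 / q) ≠ 0 := by simp [V, h.V1_ne_zero hx0, h.V1_ne_top hx0]
    have hVt : V x ^ (1 / q) ≠ ∞ := by simp [V, h.V1_ne_zero hx0, h.V1_ne_top hx0]
    calc ‖g x‖ₑ ≤ wtInv v₀ x * ‖g x‖ₑ * wt v₀ x := enorm_le_of_mul_lt_top hx
      _ = wtInv v₀ x * ‖g x‖ₑ * wt v₀ x * ((V x ^ (1 / q))⁻¹ * V x ^ (1 / q)) := by
          rw [ENNReal.inv_mul_cancel hV0 hVt, mul_one]
      _ = (B * A) x := by simp only [A, B, Pi.mul_apply]; ring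
  have hBp : ∫⁻ x in W, B x ^ p ≤ 2 ^ (p - 1) := by
    refine le_trans (le_of_eq ?_) (h.setLIntegral_window_le ht)
    congr 1; ext x
    rw [ENNReal.mul_rpow_of_nonneg _ _ hpq.nonneg, ← ENNReal.rpow_mul, one_div_mul_eq_div,
      hpq.div_conj_eq_sub_one]
  have hAq : ∀ x, A x ^ q = (wtInv v₀ x * ‖g x‖ₑ) ^ q * (V x)⁻¹ := by
    intro x
    rw [ENNReal.mul_rpow_of_nonneg _ _ hq.le, ENNReal.inv_rpow, ← ENNReal.rpow_mul,
      one_div_mul_cancel hq.ne', ENNReal.rpow_one]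
  calc (∫⁻ x in W, ‖g x‖ₑ) ^ q
      ≤ ((∫⁻ x in W, B x ^ p) ^ (1 / p) * (∫⁻ x in W, A x ^ q) ^ (1 / q)) ^ q := by
        gcongr
        exact h1.trans (ENNReal.lintegral_mul_le_Lp_mul_Lq _ hpq hB hA)
    _ ≤ ((2 ^ (p - 1)) ^ (1 / p) * (∫⁻ x in W, A x ^ q) ^ (1 / q)) ^ q := by
        have := hpq.one_div_nonneg
        gcongr
    _ = 2 * ∫⁻ x in W, A x ^ q := by
        rw [ENNReal.mul_rpow_of_nonneg _ _ hq.le, ← ENNReal.rpow_mul, ← ENNReal.rpow_mul,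
          ← ENNReal.rpow_mul, one_div_mul_cancel hq.ne', ENNReal.rpow_one]
        -- Since (p - 1) q = p, the Hölder constant is exactly 2.
        have : (p - 1) * (1 / p * q) = 1 := by
          rw [mul_comm (1 / p), ← mul_assoc, hpq.sub_one_mul_conj, mul_one_div_cancel hpq.ne_zero]
        rw [this, ENNReal.rpow_one]
    _ = _ := by simp_rw [hAq]

/-- On the window of t, 1/V₁ is at most 2/V₁(t), so the right side of `setLIntegral_window_rpow_le`
is finite, even if the window is unbounded. -/
theorem integrableOn_window (h : Balanced p v₀ v₁) {g : ℝ → ℝ}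
    (hg : MemLw p.conjExponent (wtInv v₀) g) {t : ℝ} (ht : 0 < t) :
    IntegrableOn g (window (aFun p v₀ v₁) t) := by
  have hq := h.conj.symm.pos
  refine ⟨(hg.aemeasurable.mono_measure
    (Measure.restrict_mono (window_subset_Ioi ht) le_rfl)).aestronglyMeasurable, ?_⟩
  have h1 : ∫⁻ x in Ioi (0 : ℝ), (wtInv v₀ x * ‖g x‖ₑ) ^ p.conjExponent < ∞ := by
    have := hg.norm_lt_top
    rwa [wNorm, lrNorm, ENNReal.rpow_lt_top_iff_of_pos (by positivity)] at this
  refine (ENNReal.rpow_lt_top_iff_of_pos hq).1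
    ((h.setLIntegral_window_rpow_le hg ht).trans_lt (ENNReal.mul_lt_top (by simp) ?_))
  calc ∫⁻ x in window (aFun p v₀ v₁) t,
        (wtInv v₀ x * ‖g x‖ₑ) ^ p.conjExponent * (V1 p v₀ v₁ x)⁻¹
      ≤ ∫⁻ x in window (aFun p v₀ v₁) t,
        (wtInv v₀ x * ‖g x‖ₑ) ^ p.conjExponent * (V1 p v₀ v₁ t / 2)⁻¹ := by
        refine setLIntegral_mono' (h.measurableSet_window ht) fun x hx => ?_
        gcongr
        exact ENNReal.div_le_of_le_mul' (h.V1_le_two_mul ht hx)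
    _ = (∫⁻ x in window (aFun p v₀ v₁) t, (wtInv v₀ x * ‖g x‖ₑ) ^ p.conjExponent) *
          (V1 p v₀ v₁ t / 2)⁻¹ := by
        refine lintegral_mul_const' _ _ ?_
        simp [h.V1_ne_zero ht]
    _ < ∞ := by
        refine ENNReal.mul_lt_top
          ((lintegral_mono_set (window_subset_Ioi ht)).trans_lt h1) ?_
        simp [h.V1_ne_zero ht, pos_iff_ne_zero]

theorem locallyIntegrableOn (h : Balanced p v₀ v₁) {g : ℝ → ℝ}
    (hg : MemLw p.conjExponent (wtInv v₀) g) : LocallyIntegrableOn g (Ioi 0) := by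
  have hpq := h.conj
  have hq := hpq.symm.pos
  intro x hx
  have hx : 0 < x := hx
  have hx2 : 0 < x / 2 := by positivity
  refine ⟨Icc (x / 2) (x + 1), mem_nhdsWithin_of_mem_nhds (Icc_mem_nhds (by linarith)
    (by linarith)), ?_⟩
  have hres : volume.restrict (Icc (x / 2) (x + 1)) ≤ volume.restrict (Ioi 0) :=
    Measure.restrict_mono (fun y hy => hx2.trans_le hy.1) le_rfl
  refine ⟨(hg.aemeasurable.mono_measure hres).aestronglyMeasurable, ?_⟩
  have h1 : ∫⁻ x in Ioi (0 : ℝ), (wtInv v₀ x * ‖g x‖ₑ) ^ p.conjExponent < ∞ := by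
    have := hg.norm_lt_top
    rwa [wNorm, lrNorm, ENNReal.rpow_lt_top_iff_of_pos (by positivity)] at this
  calc ∫⁻ y in Icc (x / 2) (x + 1), ‖g y‖ₑ
      ≤ ∫⁻ y in Icc (x / 2) (x + 1), (wt v₀ * fun y => wtInv v₀ y * ‖g y‖ₑ) y := by
        refine lintegral_mono_ae ?_
        filter_upwards [ae_mono hres (ae_lt_top_of_memLw hq h.weight₀ hg)] with y hy
        rw [Pi.mul_apply, mul_comm]
        exact enorm_le_of_mul_lt_top hy
    _ ≤ _ := ENNReal.lintegral_mul_le_Lp_mul_Lq _ hpq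
        (h.weight₀.aemeasurable_wt.mono_measure hres)
        ((h.weight₀.aemeasurable_wtInv.mul hg.aemeasurable.enorm).mono_measure hres)
    _ < ∞ := ENNReal.mul_lt_top
        (ENNReal.rpow_lt_top_of_nonneg hpq.one_div_nonneg
          (h.weight₀.locLr _ _ hx2 (by linarith)).ne)
        (ENNReal.rpow_lt_top_of_nonneg hpq.symm.one_div_nonneg
          ((lintegral_mono' hres le_rfl).trans_lt h1).ne)

/-- The Hardy–Steklov operator is bounded from `L^{p'}_{1/v₀}` to `L^{p'}(v₁^{-p'})`. -/
theorem hardySteklov_le (h : Balanced p v₀ v₁) {g : ℝ → ℝ}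
    (hg : MemLw p.conjExponent (wtInv v₀) g) :
    ∫⁻ t in Ioi (0 : ℝ), wtInv v₁ t ^ p.conjExponent *
        (∫⁻ x in window (aFun p v₀ v₁) t, ‖g x‖ₑ) ^ p.conjExponent ≤
      2 * ∫⁻ x in Ioi (0 : ℝ), (wtInv v₀ x * ‖g x‖ₑ) ^ p.conjExponent := by
  set q := p.conjExponent with hqdef
  set φ : ℝ → ℝ≥0∞ := fun t => wtInv v₁ t ^ q
  set G : ℝ → ℝ≥0∞ := fun x => (wtInv v₀ x * ‖g x‖ₑ) ^ q * (V1 p v₀ v₁ x)⁻¹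
  set T : Set (ℝ × ℝ) :=
    {z : ℝ × ℝ | z.1 < z.2 ∧ (Ioi (0 : ℝ)).indicator (aFun p v₀ v₁) z.2 < z.1} with hT
  have hTm : MeasurableSet T := h.measurableSet_windows
  have hφ : AEMeasurable φ (volume.restrict (Ioi 0)) := h.weight₁.aemeasurable_wtInv.pow_const q
  have hG : AEMeasurable G (volume.restrict (Ioi 0)) :=
    ((h.weight₀.aemeasurable_wtInv.mul hg.aemeasurable.enorm).pow_const q).mul
      h.aemeasurable_V1.inv
  calc ∫⁻ t in Ioi (0 : ℝ), φ t * (∫⁻ x in window (aFun p v₀ v₁) t, ‖g x‖ₑ) ^ q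
      ≤ ∫⁻ t in Ioi (0 : ℝ), 2 * ∫⁻ x in Ioi (0 : ℝ),
          T.indicator (fun z => φ z.1 * G z.2) (t, x) := by
        refine setLIntegral_mono' measurableSet_Ioi fun t ht => ?_
        have ht : 0 < t := ht
        have e1 : ∀ x, T.indicator (fun z => φ z.1 * G z.2) (t, x) =
            (window (aFun p v₀ v₁) t).indicator (fun x => φ t * G x) x := by
          intro x
          by_cases hx : x ∈ window (aFun p v₀ v₁) t
          · rw [indicator_of_mem hx, indicator_of_mem ((mem_window_iff ht x).1 hx)]
          · rw [indicator_of_notMem hx, indicator_of_notMem (mt (mem_window_iff ht x).2 hx)]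
        simp_rw [e1]
        rw [lintegral_indicator (h.measurableSet_window ht),
          Measure.restrict_restrict (h.measurableSet_window ht),
          inter_eq_left.2 (window_subset_Ioi ht), lintegral_const_mul'' _ (hG.mono_measure
            (Measure.restrict_mono (window_subset_Ioi ht) le_rfl)), mul_left_comm]
        gcongr
        exact h.setLIntegral_window_rpow_le hg ht
    _ = 2 * ∫⁻ t in Ioi (0 : ℝ), ∫⁻ x in Ioi (0 : ℝ),
          T.indicator (fun z => φ z.1 * G z.2) (t, x) := lintegral_const_mul' _ _ (by simp)
    _ = 2 * ∫⁻ x in Ioi (0 : ℝ), ∫⁻ t in Ioi (0 : ℝ),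
          T.indicator (fun z => φ z.1 * G z.2) (t, x) := by
        congr 1
        refine lintegral_lintegral_swap ?_
        exact (hφ.comp_fst.mul hG.comp_snd).indicator hTm
    _ ≤ 2 * ∫⁻ x in Ioi (0 : ℝ), (wtInv v₀ x * ‖g x‖ₑ) ^ q := by
        refine mul_le_mul_right (setLIntegral_mono' measurableSet_Ioi fun x hx => ?_) 2
        have hx : 0 < x := hx
        -- For fixed x, the section of T in t is (a(x), x); its mass is at most V₁(x), which cancels
        -- the factor 1/V₁(x) in G.
        have hsub : Ioo (aFun p v₀ v₁ x) x ⊆ Ioi 0 := fun t ht => (h.aFun_pos hx).trans ht.1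
        calc ∫⁻ t in Ioi (0 : ℝ), T.indicator (fun z => φ z.1 * G z.2) (t, x)
            ≤ ∫⁻ t in Ioi (0 : ℝ),
                (Ioo (aFun p v₀ v₁ x) x).indicator (fun t => φ t * G x) t := by
              refine lintegral_mono fun t => ?_
              by_cases htx : (t, x) ∈ T
              · have h2 := htx.2
                rw [indicator_of_mem (mem_Ioi.2 hx)] at h2
                have h3 : t ∈ Ioo (aFun p v₀ v₁ x) x := ⟨h2, htx.1⟩
                rw [indicator_of_mem h3, indicator_of_mem htx]
              · rw [indicator_of_notMem htx]; exact bot_le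
          _ = ∫⁻ t in Ioo (aFun p v₀ v₁ x) x, φ t * G x := by
              rw [lintegral_indicator measurableSet_Ioo,
                Measure.restrict_restrict measurableSet_Ioo,
                inter_eq_left.2 hsub]
          _ = massInv p v₁ (aFun p v₀ v₁ x) x * G x :=
              lintegral_mul_const'' _ (hφ.mono_measure (Measure.restrict_mono hsub le_rfl))
          _ ≤ V1 p v₀ v₁ x * G x := by gcongr; exact h.massInv_aFun_le_V1 hx le_rfl
          _ = (wtInv v₀ x * ‖g x‖ₑ) ^ q * (V1 p v₀ v₁ x * (V1 p v₀ v₁ x)⁻¹) := by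
              simp only [G]; ring
          _ = _ := by rw [ENNReal.mul_inv_cancel (h.V1_ne_zero hx) (h.V1_ne_top hx), mul_one]

/-! ### Bounds for 𝔾 and 𝒢 -/

theorem two_rpow_mul_rpow_le (h : Balanced p v₀ v₁) {K I : ℝ≥0∞} (hI : I ≤ 2 * K) :
    I ^ (1 / p.conjExponent) ≤ 2 * K ^ (1 / p.conjExponent) := by
  have hq := h.conj.symm
  calc I ^ (1 / p.conjExponent) ≤ (2 * K) ^ (1 / p.conjExponent) :=
        ENNReal.rpow_le_rpow hI hq.one_div_nonneg
    _ = 2 ^ (1 / p.conjExponent) * K ^ (1 / p.conjExponent) :=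
        ENNReal.mul_rpow_of_nonneg _ _ hq.one_div_nonneg
    _ ≤ 2 ^ (1 : ℝ) * K ^ (1 / p.conjExponent) := by
        gcongr
        · norm_num
        · rw [div_le_one hq.pos]; exact hq.lt.le
    _ = _ := by rw [ENNReal.rpow_one]

/-- For x in the window of t, (a(x), t) lies in (a(x), b(x)), so the kernel divided by V₁(x) is at
most 1. -/
theorem bbG_le (h : Balanced p v₀ v₁) {g : ℝ → ℝ} (hg : MemLw p.conjExponent (wtInv v₀) g) :
    bbG p v₀ v₁ g ≤ 2 * wNorm p.conjExponent (wtInv v₀) g := by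
  have hq := h.conj.symm.pos
  refine h.two_rpow_mul_rpow_le (le_trans ?_ (h.hardySteklov_le hg))
  refine setLIntegral_mono' measurableSet_Ioi fun t ht => ?_
  have ht : 0 < t := ht
  gcongr
  refine (enorm_integral_le_lintegral_enorm _).trans
    (setLIntegral_mono' (h.measurableSet_window ht) fun x hx => ?_)
  have hx0 : 0 < x := ht.trans hx.1
  have hle : (massInv p v₁ (aFun p v₀ v₁ x) t).toReal ≤ (V1 p v₀ v₁ x).toReal :=
    ENNReal.toReal_mono (h.V1_ne_top hx0) (h.massInv_aFun_le_V1 hx0 hx.1.le)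
  rw [enorm_le_iff_norm_le, div_mul_eq_mul_div, mul_div_assoc, norm_mul]
  refine mul_le_of_le_one_right (norm_nonneg _) ?_
  rw [Real.norm_of_nonneg (by positivity)]
  exact div_le_one_of_le₀ hle ENNReal.toReal_nonneg

/-- One factor 2 comes from V₁(t) ≤ 2 V₁(x) on the window of t, the other from the Hardy–Steklov
bound. -/
theorem calG_le (h : Balanced p v₀ v₁) {g : ℝ → ℝ} (hg : MemLw p.conjExponent (wtInv v₀) g) :
    calG p v₀ v₁ g ≤ 4 * wNorm p.conjExponent (wtInv v₀) g := by
  have hq := h.conj.symm.pos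
  set q := p.conjExponent with hqdef
  have key : ∀ t, 0 < t →
      V1 p v₀ v₁ t * ‖∫ x in window (aFun p v₀ v₁) t, g x / (V1 p v₀ v₁ x).toReal‖ₑ ≤
        2 * ∫⁻ x in window (aFun p v₀ v₁) t, ‖g x‖ₑ := by
    intro t ht
    calc _ ≤ V1 p v₀ v₁ t *
          ∫⁻ x in window (aFun p v₀ v₁) t, ‖g x / (V1 p v₀ v₁ x).toReal‖ₑ := by
          gcongr; exact enorm_integral_le_lintegral_enorm _
      _ = ∫⁻ x in window (aFun p v₀ v₁) t,
            V1 p v₀ v₁ t * ‖g x / (V1 p v₀ v₁ x).toReal‖ₑ :=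
          (lintegral_const_mul' _ _ (h.V1_ne_top ht)).symm
      _ ≤ ∫⁻ x in window (aFun p v₀ v₁) t, 2 * ‖g x‖ₑ := by
          refine setLIntegral_mono' (h.measurableSet_window ht) fun x hx => ?_
          have hx0 : 0 < x := ht.trans hx.1
          have e : ‖g x / (V1 p v₀ v₁ x).toReal‖ₑ = ‖g x‖ₑ * (V1 p v₀ v₁ x)⁻¹ := by
            rw [div_eq_mul_inv, enorm_mul, enorm_inv
              (ENNReal.toReal_pos (h.V1_ne_zero hx0) (h.V1_ne_top hx0)).ne',
              Real.enorm_of_nonneg ENNReal.toReal_nonneg, ENNReal.ofReal_toReal (h.V1_ne_top hx0)]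
          calc _ ≤ (2 * V1 p v₀ v₁ x) * (‖g x‖ₑ * (V1 p v₀ v₁ x)⁻¹) := by
                rw [e]; gcongr; exact h.V1_le_two_mul ht hx
            _ = 2 * ‖g x‖ₑ * (V1 p v₀ v₁ x * (V1 p v₀ v₁ x)⁻¹) := by ring
            _ = _ := by rw [ENNReal.mul_inv_cancel (h.V1_ne_zero hx0) (h.V1_ne_top hx0), mul_one]
      _ = _ := lintegral_const_mul' _ _ (by simp)
  have hI : ∫⁻ t in Ioi (0 : ℝ), wtInv v₁ t ^ q * V1 p v₀ v₁ t ^ q *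
      ‖∫ x in window (aFun p v₀ v₁) t, g x / (V1 p v₀ v₁ x).toReal‖ₑ ^ q ≤
      2 ^ q * ∫⁻ t in Ioi (0 : ℝ), wtInv v₁ t ^ q *
        (∫⁻ x in window (aFun p v₀ v₁) t, ‖g x‖ₑ) ^ q := by
    rw [← lintegral_const_mul' _ _ (ENNReal.rpow_ne_top_of_nonneg hq.le (by simp))]
    refine setLIntegral_mono' measurableSet_Ioi fun t ht => ?_
    rw [mul_assoc, ← ENNReal.mul_rpow_of_nonneg _ _ hq.le, mul_left_comm,
      ← ENNReal.mul_rpow_of_nonneg 2 _ hq.le]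
    exact mul_le_mul_right (ENNReal.rpow_le_rpow (key t ht) hq.le) _
  calc calG p v₀ v₁ g ≤ (2 ^ q * ∫⁻ t in Ioi (0 : ℝ), wtInv v₁ t ^ q *
        (∫⁻ x in window (aFun p v₀ v₁) t, ‖g x‖ₑ) ^ q) ^ (1 / q) :=
        ENNReal.rpow_le_rpow hI h.conj.symm.one_div_nonneg
    _ = 2 * (∫⁻ t in Ioi (0 : ℝ), wtInv v₁ t ^ q *
        (∫⁻ x in window (aFun p v₀ v₁) t, ‖g x‖ₑ) ^ q) ^ (1 / q) := by
        rw [ENNReal.mul_rpow_of_nonneg _ _ h.conj.symm.one_div_nonneg, ← ENNReal.rpow_mul,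
          mul_one_div_cancel hq.ne', ENNReal.rpow_one]
    _ ≤ 2 * (2 * wNorm q (wtInv v₀) g) := by
        gcongr
        exact h.two_rpow_mul_rpow_le (h.hardySteklov_le hg)
    _ = _ := by rw [← mul_assoc]; norm_num

theorem memW_and_normW_le (h : Balanced p v₀ v₁) {g : ℝ → ℝ}
    (hg : MemLw p.conjExponent (wtInv v₀) g) :
    MemW p v₀ v₁ g ∧
      normW p v₀ v₁ g ≤ ENNReal.ofReal 6 * wNorm p.conjExponent (wtInv v₀) g := by
  have hN : normW p v₀ v₁ g ≤ ENNReal.ofReal 6 * wNorm p.conjExponent (wtInv v₀) g := by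
    refine (add_le_add (h.bbG_le hg) (h.calG_le hg)).trans_eq ?_
    rw [← add_mul]
    norm_num
  exact ⟨⟨h.locallyIntegrableOn hg, fun t ht => h.integrableOn_window hg ht,
    hN.trans_lt (ENNReal.mul_lt_top (by simp) hg.norm_lt_top)⟩, hN⟩

end Balanced

end WeightedSobolev

theorem mainTheorem6 (p : ℝ) (hp : 1 < p) :
    ∃ C : ℝ, 0 < C ∧ ∀ v₀ v₁ : ℝ → ℝ,
      WeightedSobolev.IsWeight p v₀ → WeightedSobolev.IsWeight p v₁ →
      WeightedSobolev.LocLr p.conjExponent (WeightedSobolev.wtInv v₁) →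
      WeightedSobolev.DivergenceCondition p v₀ v₁ →
      (∀ g : ℝ → ℝ,
        WeightedSobolev.MemLw p.conjExponent (WeightedSobolev.wtInv v₀) g →
          WeightedSobolev.MemW p v₀ v₁ g ∧
          WeightedSobolev.normW p v₀ v₁ g ≤
            ENNReal.ofReal C *
              WeightedSobolev.wNorm p.conjExponent (WeightedSobolev.wtInv v₀) g) ∧
      (∀ f : ℝ → ℝ,
        WeightedSobolev.MemD (WeightedSobolev.MemW p v₀ v₁) f →
          WeightedSobolev.MemLw p (WeightedSobolev.wt v₀) f ∧
          WeightedSobolev.wNorm p (WeightedSobolev.wt v₀) f ≤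
            ENNReal.ofReal C *
              WeightedSobolev.weakJ (WeightedSobolev.MemW p v₀ v₁)
                (WeightedSobolev.normW p v₀ v₁) f) := by
  -- The constant is 2 from 𝔾 plus 4 from 𝒢; duality passes it on unchanged.
  refine ⟨6, by norm_num, fun v₀ v₁ h₀ h₁ hloc hdiv => ?_⟩
  have h : WeightedSobolev.Balanced p v₀ v₁ := ⟨hp, h₀, h₁, hloc, fun t ht =>
    WeightedSobolev.isBalancedPair_balancedPair hp h₀ h₁ hloc hdiv ht⟩
  exact ⟨fun g hg => h.memW_and_normW_le hg, fun f hf =>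
    WeightedSobolev.memLw_and_wNorm_le_weakJ h.conj h₀.aemeasurable (by norm_num)
      (fun g hg => h.memW_and_normW_le hg) hf⟩
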